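/- Let $N>3$ and let $|\Psi\rangle\in\mathbb{C}^{d_1}\otimes\cdots\otimes\mathbb{C}^{d_N}$ be a pure state (unit vector) of $N$ parties with arbitrary finite local dimensions. For a set $S$ of parties let $C_S(\Psi)=\sqrt{2\,(1-\mathrm{Tr}\,\rho_S^2)}$ be the concurrence across the bipartition $S|S^c$, where $\rho_S$ is the reduced density matrix of $|\Psi\rangle\langle\Psi|$ on $S$. Put $$a=\Big(\prod_{i=1}^N C_{\{i\}}(\Psi)\Big)^{1/N},\qquad h=\Big(\prod_{S|S^c} C_S(\Psi)\Big)^{1/(2^{N-1}-N-1)},$$ where the second product runs over the $2^{N-1}-N-1$ unordered bipartitions both of whose sides contain at least two parties, each taken once. Let $$V(\Psi)=\frac{N a^2}{12}\cot\Big(\frac{\pi}{N}\Big)\,h .$$ Then $V(\Psi)$ is the volume of the right pyramid of height $h$ over a regular $N$-gon of side length $a$, and $V$ is a measure of genuine multipartite entanglement for pure states: (i) $V(\Psi)=0$ if $|\Psi\rangle\langle\Psi|$ is biseparable, i.e. a convex combination of projectors onto pure states each of which is a product across some bipartition (which may depend on the term); (ii) $V(\Psi)>0$ if $|\Psi\rangle\langle\Psi|$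 is not biseparable; (iii) $V(\Phi)\le V(\Psi)$ whenever $|\Phi\rangle\langle\Phi|=\Lambda(|\Psi\rangle\langle\Psi|)$ for pure states $\Psi,\Phi$ and a finite-round LOCC map $\Lambda$ (which may change the local dimensions). Moreover $V\ge 0$, and $V(\Psi)=0$ if and only if $|\Psi\rangle$ is a product across some bipartition into two non-empty sets of parties. As a function of non-negative values of the concurrences that enter it, $V$ is non-decreasing in all of them, and strictly increasing in each of them when the others are positive. For $N=4$ one has $V(\Psi)=\frac13a^2h$ with $a=(C_{\{1\}}C_{\{2\}}C_{\{3\}}C_{\{4\}})^{1/4}$ and $h=(C_{\{1,2\}}C_{\{1,3\}}C_{\{1,4\}})^{1/3}$. -/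

import Mathlib

noncomputable section

namespace GME

/-- Labels of the product basis of `ℂ^{d 0} ⊗ ⋯ ⊗ ℂ^{d (N-1)}`. -/
abbrev Idx {N : ℕ} (d : Fin N → ℕ) : Type := ∀ i, Fin (d i)

/-- The Hilbert space `ℂ^{d 0} ⊗ ⋯ ⊗ ℂ^{d (N-1)}`, in coordinates with respect to the product
basis. Its unit vectors are the pure states of `N` parties. -/
abbrev Ket {N : ℕ} (d : Fin N → ℕ) : Type := EuclideanSpace ℂ (Idx d)

/-- Operators from the system with local dimensions `d` to the one with local dimensions `e`. -/
abbrev Op {N : ℕ} (e d : Fin N → ℕ) : Type := Matrix (Idx e) (Idx d) ℂ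

/-- The operator `|ψ⟩⟨ψ|`. -/
def density {N : ℕ} {d : Fin N → ℕ} (ψ : Ket d) : Op d d :=
  Matrix.of fun x y => ψ x * star (ψ y)

/-- Labels of the product basis of the subsystem formed by the parties in `S`. -/
abbrev SubIdx {N : ℕ} (d : Fin N → ℕ) (S : Finset (Fin N)) : Type :=
  ∀ i : {i : Fin N // i ∈ S}, Fin (d i)

/-- Labels of the product basis of the subsystem formed by the parties outside `S`. -/
abbrev CoIdx {N : ℕ} (d : Fin N → ℕ) (S : Finset (Fin N)) : Type :=
  ∀ i : {i : Fin N // i ∉ S}, Fin (d i)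

/-- The label of the whole system made of a label on `S` and a label outside `S`. -/
def glue {N : ℕ} {d : Fin N → ℕ} (S : Finset (Fin N)) (x : SubIdx d S) (z : CoIdx d S) : Idx d :=
  fun i => if h : i ∈ S then x ⟨i, h⟩ else z ⟨i, h⟩

/-- The reduced operator on the parties in `S`: all the other parties are traced out. -/
def partialTrace {N : ℕ} {d : Fin N → ℕ} (S : Finset (Fin N)) (ρ : Op d d) :
    Matrix (SubIdx d S) (SubIdx d S) ℂ :=
  Matrix.of fun x y => ∑ z : CoIdx d S, ρ (glue S x z) (glue S y z)

/-- The concurrence `√(2 (1 - Tr ρ_S²))` of a pure state across the bipartition `S | Sᶜ`. -/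
def concurrence {N : ℕ} {d : Fin N → ℕ} (ψ : Ket d) (S : Finset (Fin N)) : ℝ :=
  Real.sqrt (2 * (1 - (Matrix.trace
    (partialTrace S (density ψ) * partialTrace S (density ψ))).re))

/-- `ψ = φ ⊗ χ` with `φ` a vector of the parties in `S` and `χ` one of the other parties. -/
def IsProductAcross {N : ℕ} {d : Fin N → ℕ} (ψ : Ket d) (S : Finset (Fin N)) : Prop :=
  ∃ (φ : EuclideanSpace ℂ (SubIdx d S)) (χ : EuclideanSpace ℂ (CoIdx d S)),
    ∀ (x : SubIdx d S) (z : CoIdx d S), ψ (glue S x z) = φ x * χ z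

/-- `ψ` is a product across some bipartition of the parties into two non-empty parts. -/
def IsProductAcrossSome {N : ℕ} {d : Fin N → ℕ} (ψ : Ket d) : Prop :=
  ∃ S : Finset (Fin N), S.Nonempty ∧ S ≠ Finset.univ ∧ IsProductAcross ψ S

/-- Biseparable states: convex combinations of (projectors onto) pure states each of which is a
product across some bipartition, where the bipartition may differ from term to term. -/
def IsBiseparable {N : ℕ} {d : Fin N → ℕ} (ρ : Op d d) : Prop :=
  ρ ∈ convexHull ℝ {σ : Op d d | ∃ φ : Ket d, ‖φ‖ = 1 ∧ IsProductAcrossSome φ ∧ σ = density φ}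

/-- The operator acting as `K` on party `i` and as the identity on every other party. It is used
when `e` and `d` agree away from `i`. -/
def localOp {N : ℕ} {d e : Fin N → ℕ} (i : Fin N) (K : Matrix (Fin (e i)) (Fin (d i)) ℂ) :
    Op e d :=
  Matrix.of fun x y => if ∀ j, j ≠ i → (x j : ℕ) = (y j : ℕ) then K (x i) (y i) else 0

/-- `IsLOCC d' d Λ`: the map `Λ`, from operators of the system with local dimensions `d` to those
of the system with local dimensions `d'`, is implemented by local operations and classical
communication. In a protocol of finitely many rounds, in each round one party `i` performs a local
measurement with Kraus operators `K k`, `∑ k, (K k)† (K k) = 1` (the dimension of its system may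
change), and announces the outcome `k`, on which the rest of the protocol may depend; at the end
the outcomes are forgotten. -/
inductive IsLOCC {N : ℕ} (d' : Fin N → ℕ) : (d : Fin N → ℕ) → (Op d d → Op d' d') → Prop
  | done : IsLOCC d' d' (fun ρ => ρ)
  | step {d e : Fin N → ℕ} (i : Fin N) (hde : ∀ j, j ≠ i → e j = d j) {m : ℕ}
      (K : Fin m → Matrix (Fin (e i)) (Fin (d i)) ℂ)
      (hK : ∑ k, Matrix.conjTranspose (K k) * K k = 1)
      (Λ : Fin m → (Op e e → Op d' d')) (hΛ : ∀ k, IsLOCC d' e (Λ k)) :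
      IsLOCC d' d (fun ρ => ∑ k, Λ k
        ((localOp i (K k) : Op e d) * ρ * Matrix.conjTranspose (localOp i (K k) : Op e d)))

/-- A measure of genuine multipartite entanglement for pure states of `N` parties with arbitrary
local dimensions: it vanishes on biseparable states, is positive on all the others, and does not
increase when an LOCC map transforms a pure state into a pure state. -/
structure IsGMEMeasure (N : ℕ) (E : ∀ d : Fin N → ℕ, Ket d → ℝ) : Prop where
  zero_of_biseparable : ∀ (d : Fin N → ℕ) (ψ : Ket d), ‖ψ‖ = 1 →
    IsBiseparable (density ψ) → E d ψ = 0
  pos_of_not_biseparable : ∀ (d : Fin N → ℕ) (ψ : Ket d), ‖ψ‖ = 1 →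
    ¬ IsBiseparable (density ψ) → 0 < E d ψ
  locc_le : ∀ (d d' : Fin N → ℕ) (Λ : Op d d → Op d' d'), IsLOCC d' d Λ →
    ∀ (ψ : Ket d) (φ : Ket d'), ‖ψ‖ = 1 → ‖φ‖ = 1 → Λ (density ψ) = density φ → E d' φ ≤ E d ψ

/-- The bipartitions of `N` parties in which both sides have at least two parties, each given once,
by its smaller side, or by the side containing the first party when the sides have equal size. -/
def higherBipartitions (N : ℕ) : Finset (Finset (Fin N)) :=
  Finset.univ.filter fun S =>
    2 ≤ S.card ∧ (2 * S.card < N ∨ (2 * S.card = N ∧ ∃ i ∈ S, (i : ℕ) = 0))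

/-- The geometric mean of the values of `c` at the one-party bipartitions. -/
def baseLength {N : ℕ} (c : Finset (Fin N) → ℝ) : ℝ :=
  (∏ i : Fin N, c {i}) ^ (1 / (N : ℝ))

/-- The geometric mean of the values of `c` at all the other bipartitions. -/
def height {N : ℕ} (c : Finset (Fin N) → ℝ) : ℝ :=
  (∏ S ∈ higherBipartitions N, c S) ^ (1 / ((2 : ℝ) ^ (N - 1) - (N : ℝ) - 1))

/-- The volume attached to the values `c S` at all bipartitions. -/
def pyramidVolume {N : ℕ} (c : Finset (Fin N) → ℝ) : ℝ :=
  (N : ℝ) * baseLength c ^ 2 / 12 * Real.cot (Real.pi / (N : ℝ)) * height c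

/-- The volume attached to the concurrences of a pure state. -/
def V {N : ℕ} (d : Fin N → ℕ) (ψ : Ket d) : ℝ := pyramidVolume (concurrence ψ)

/-- The right pyramid of height `h` over a regular `N`-gon of side length `a`, in the
three-dimensional space `ℂ × ℝ`, the horizontal plane being identified with `ℂ`. The vertices of
the base lie on the circle of radius `a / (2 sin (π / N))`. -/
def regularPyramid (N : ℕ) (a h : ℝ) : Set (ℂ × ℝ) :=
  convexHull ℝ (insert ((0 : ℂ), h) (Set.range fun k : Fin N =>
    (((a / (2 * Real.sin (Real.pi / (N : ℝ))) : ℝ) : ℂ) *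
      Complex.exp ((2 * Real.pi * ((k : ℕ) : ℝ) / (N : ℝ) : ℝ) * Complex.I), (0 : ℝ))))

/-- The four-party volume `a² h / 3`, written out. -/
def V1234 (d : Fin 4 → ℕ) (ψ : Ket d) : ℝ :=
  1 / 3 *
    ((concurrence ψ {0} * concurrence ψ {1} * concurrence ψ {2} * concurrence ψ {3})
      ^ (1 / 4 : ℝ)) ^ 2 *
    (concurrence ψ {0, 1} * concurrence ψ {0, 2} * concurrence ψ {0, 3}) ^ (1 / 3 : ℝ)

end GME

end

/-! For a unit vector the squared concurrence across `S` is the sum of the squared 2 × 2 minors of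
the coefficient matrix `A` of `ψ` (rows `S`, columns the complement): `minorSum_eq`. Its root
`minorNorm` makes sense for all vectors, is homogeneous of degree two, is unchanged when `S` is
replaced by its complement, and vanishes exactly when `A` has rank at most one, that is, on products
across `S`.

Monotonicity under LOCC is proved for each bipartition separately. After passing to the complement
if necessary, the acting party lies outside `S`, so its Kraus operators send `A` to `A * M k` with
`∑ k, M k * (M k)ᴴ = 1`. The matrices `A * M k * (A * M k)ᴴ` then add up to `A * Aᴴ`, and `R ↦ √((tr
R)² - ‖R‖²)` is superadditive by the reverse triangle inequality of Minkowski space. Hence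
`minorNorm` does not increase on average (`sum_sqrt_minorSum_mul_le`, `IsLOCC.exists_ensemble`). If
the final state is pure, all branches are multiples `c k • φ` with `∑ ‖c k‖² = 1`
(`exists_smul_of_density_eq_sum`), and homogeneity turns the average into the concurrence of `φ`.
The same rigidity of pure states identifies biseparable pure states with products.

Since `V` is a product of positive powers of all the concurrences, it inherits monotonicity and
vanishes iff one of them does. The geometric claim is independent: the polygon minus its centre is
cut into `N` rotated triangles, and the pyramid is integrated over horizontal slices. -/

noncomputable section
namespace GME
open Matrix

/-! ### Sums of squared 2 × 2 minors -/

/-- The sum of the squared absolute values of the `2 × 2` minors, over ordered pairs of rows and of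
columns. -/
def minorSum {X Z : Type*} [Fintype X] [Fintype Z] (A : Matrix X Z ℂ) : ℝ :=
  ∑ x, ∑ y, ∑ z, ∑ w, ‖A x z * A y w - A y z * A x w‖ ^ 2

section minorSum

variable {X Y Z W : Type*} [Fintype X] [Fintype Y] [Fintype Z] [Fintype W]

theorem minorSum_nonneg (A : Matrix X Z ℂ) : 0 ≤ minorSum A := by
  unfold minorSum; positivity

theorem minorSum_transpose (A : Matrix X Z ℂ) : minorSum Aᵀ = minorSum A := by
  have comm : ∀ f : Z → Z → X → X → ℝ,
      ∑ z, ∑ w, ∑ x, ∑ y, f z w x y = ∑ x, ∑ y, ∑ z, ∑ w, f z w x y := fun f => by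
    rw [Finset.sum_congr rfl fun z _ => Finset.sum_comm, Finset.sum_comm]
    refine Finset.sum_congr rfl fun x _ => ?_
    rw [Finset.sum_congr rfl fun z _ => Finset.sum_comm, Finset.sum_comm]
  simp only [minorSum, transpose_apply]
  rw [comm]
  refine Finset.sum_congr rfl fun x _ => Finset.sum_congr rfl fun y _ =>
    Finset.sum_congr rfl fun z _ => Finset.sum_congr rfl fun w _ => ?_
  rw [mul_comm (A x w)]

theorem minorSum_reindex (A : Matrix X Z ℂ) (f : Y ≃ X) (g : W ≃ Z) :
    minorSum (A.submatrix f g) = minorSum A := by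
  simp only [minorSum, submatrix_apply]
  refine Fintype.sum_equiv f _ _ fun x => Fintype.sum_equiv f _ _ fun y =>
    Fintype.sum_equiv g _ _ fun z => Fintype.sum_equiv g _ _ fun w => rfl

theorem minorSum_smul (c : ℂ) (A : Matrix X Z ℂ) : minorSum (c • A) = ‖c‖ ^ 4 * minorSum A := by
  simp only [minorSum, Finset.mul_sum, Matrix.smul_apply, smul_eq_mul]
  refine Finset.sum_congr rfl fun x _ => Finset.sum_congr rfl fun y _ =>
    Finset.sum_congr rfl fun z _ => Finset.sum_congr rfl fun w _ => ?_
  rw [show c * A x z * (c * A y w) - c * A y z * (c * A x w) =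
    c ^ 2 * (A x z * A y w - A y z * A x w) by ring, norm_mul, norm_pow]
  ring

theorem minorSum_eq_zero_iff (A : Matrix X Z ℂ) :
    minorSum A = 0 ↔ ∃ (u : X → ℂ) (v : Z → ℂ), ∀ x z, A x z = u x * v z := by
  constructor
  · intro h
    have key : ∀ x y z w, A x z * A y w = A y z * A x w := by
      intro x y z w
      unfold minorSum at h
      rw [Finset.sum_eq_zero_iff_of_nonneg (fun _ _ => by positivity)] at h
      have h := h x (Finset.mem_univ _)
      rw [Finset.sum_eq_zero_iff_of_nonneg (fun _ _ => by positivity)] at h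
      have h := h y (Finset.mem_univ _)
      rw [Finset.sum_eq_zero_iff_of_nonneg (fun _ _ => by positivity)] at h
      have h := h z (Finset.mem_univ _)
      rw [Finset.sum_eq_zero_iff_of_nonneg (fun _ _ => by positivity)] at h
      have h := h w (Finset.mem_univ _)
      simpa [sub_eq_zero] using h
    by_cases h0 : ∃ y w, A y w ≠ 0
    · obtain ⟨y, w, hyw⟩ := h0
      -- Rank-one factorization through the nonzero pivot `A y w`: its column times its row, divided
      -- by the pivot.
      refine ⟨fun x => A x w, fun z => A y z / A y w, fun x z => ?_⟩
      field_simp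
      linear_combination key x y z w
    · push Not at h0
      exact ⟨0, 0, by simp [h0]⟩
  · rintro ⟨u, v, h⟩
    simp only [minorSum, h]
    refine Finset.sum_eq_zero fun x _ => Finset.sum_eq_zero fun y _ =>
      Finset.sum_eq_zero fun z _ => Finset.sum_eq_zero fun w _ => ?_
    rw [show u x * v z * (u y * v w) - u y * v z * (u x * v w) = 0 by ring]
    simp

theorem norm_sq_minor (a b c d : ℂ) :
    ‖a * b - c * d‖ ^ 2 = ‖a‖ ^ 2 * ‖b‖ ^ 2 + ‖c‖ ^ 2 * ‖d‖ ^ 2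
      - 2 * (a * star c * (b * star d)).re := by
  simp only [← Complex.normSq_eq_norm_sq, Complex.normSq_sub, map_mul]
  congr 2
  simp only [Complex.star_def]
  ring_nf

theorem mul_conjTranspose_self_sq_sum (A : Matrix X Z ℂ) :
    ∑ x, ∑ y, ‖(A * Aᴴ) x y‖ ^ 2 =
      ∑ x, ∑ y, ∑ z, ∑ w, (A x z * star (A y z) * (A y w * star (A x w))).re := by
  refine Finset.sum_congr rfl fun x _ => Finset.sum_congr rfl fun y _ => ?_
  have : ((‖(A * Aᴴ) x y‖ ^ 2 : ℝ) : ℂ) = (A * Aᴴ) x y * star ((A * Aᴴ) x y) := by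
    rw [Complex.star_def, Complex.mul_conj, Complex.normSq_eq_norm_sq]
  rw [← Complex.ofReal_re (‖(A * Aᴴ) x y‖ ^ 2), this]
  simp only [mul_apply, conjTranspose_apply, star_sum, Finset.sum_mul_sum, Complex.re_sum]
  refine Finset.sum_congr rfl fun z _ => Finset.sum_congr rfl fun w _ => ?_
  simp [mul_comm]

/-- Expanding each squared minor, the two diagonal terms both sum to the square of the total weight,
and the cross terms sum to the squared Frobenius norm of `A * Aᴴ`. -/
theorem minorSum_eq (A : Matrix X Z ℂ) :
    minorSum A = 2 * ((∑ x, ∑ z, ‖A x z‖ ^ 2) ^ 2 - ∑ x, ∑ y, ‖(A * Aᴴ) x y‖ ^ 2) := by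
  have h1 : ∑ x, ∑ y, ∑ z, ∑ w, ‖A x z‖ ^ 2 * ‖A y w‖ ^ 2 = (∑ x, ∑ z, ‖A x z‖ ^ 2) ^ 2 := by
    rw [sq, Finset.sum_mul_sum]
    simp only [Finset.sum_mul_sum]
  have h2 : ∑ x, ∑ y, ∑ z, ∑ w, ‖A y z‖ ^ 2 * ‖A x w‖ ^ 2 = (∑ x, ∑ z, ‖A x z‖ ^ 2) ^ 2 := by
    rw [Finset.sum_comm, h1]
  rw [mul_conjTranspose_self_sq_sum, minorSum]
  simp only [norm_sq_minor, Finset.sum_sub_distrib, Finset.sum_add_distrib, h1, h2]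
  simp only [← Finset.mul_sum]
  ring

theorem trace_mul_conjTranspose_sq (A : Matrix X Z ℂ) :
    (trace (A * Aᴴ * (A * Aᴴ))).re = ∑ x, ∑ y, ‖(A * Aᴴ) x y‖ ^ 2 := by
  simp only [trace, diag_apply, Complex.re_sum]
  refine Finset.sum_congr rfl fun x _ => ?_
  rw [mul_apply, Complex.re_sum]
  refine Finset.sum_congr rfl fun y _ => ?_
  have : (A * Aᴴ) y x = star ((A * Aᴴ) x y) := by
    rw [← conjTranspose_apply, conjTranspose_mul, conjTranspose_conjTranspose]
  rw [this, Complex.star_def, Complex.mul_conj, Complex.normSq_eq_norm_sq, Complex.ofReal_re]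

end minorSum

/-! ### Superadditivity and the average decrease under Kraus operators -/

/-- The reverse triangle inequality for the Lorentz length on the forward cone, in two dimensions.
-/
theorem sqrt_sq_sub_sq_add_le {s t a b : ℝ} (ha : 0 ≤ a) (hb : 0 ≤ b) (hs : a ≤ s) (ht : b ≤ t) :
    √(s ^ 2 - a ^ 2) + √(t ^ 2 - b ^ 2) ≤ √((s + t) ^ 2 - (a + b) ^ 2) := by
  have h1 : 0 ≤ s ^ 2 - a ^ 2 := by nlinarith
  have h2 : 0 ≤ t ^ 2 - b ^ 2 := by nlinarith
  apply Real.le_sqrt_of_sq_le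
  -- Reverse Cauchy–Schwarz: the squares of the two sides differ by `(s * b - t * a) ^ 2`.
  have h3 : √(s ^ 2 - a ^ 2) * √(t ^ 2 - b ^ 2) ≤ s * t - a * b := by
    rw [← Real.sqrt_mul h1]
    apply Real.sqrt_le_iff.2 ⟨by nlinarith [mul_le_mul hs ht hb (ha.trans hs)], ?_⟩
    nlinarith [sq_nonneg (s * b - t * a)]
  nlinarith [Real.sq_sqrt h1, Real.sq_sqrt h2]

theorem sum_sqrt_sq_sub_norm_sq_le {E κ : Type*} [SeminormedAddCommGroup E] (I : Finset κ)
    (t : κ → ℝ) (v : κ → E) (h : ∀ k, ‖v k‖ ≤ t k) :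
    ∑ k ∈ I, √(t k ^ 2 - ‖v k‖ ^ 2) ≤ √((∑ k ∈ I, t k) ^ 2 - ‖∑ k ∈ I, v k‖ ^ 2) := by
  classical
  induction I using Finset.induction_on with
  | empty => simp
  | insert k I hk ih =>
    rw [Finset.sum_insert hk, Finset.sum_insert hk, Finset.sum_insert hk]
    refine (add_le_add_right ih _).trans ((sqrt_sq_sub_sq_add_le (norm_nonneg _) (norm_nonneg _)
      (h k) ((norm_sum_le _ _).trans (Finset.sum_le_sum fun k _ => h k))).trans
      (Real.sqrt_le_sqrt ?_))
    gcongr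
    exact norm_add_le _ _

theorem sum_sum_norm_sq_eq_trace {X Z : Type*} [Fintype X] [Fintype Z] (A : Matrix X Z ℂ) :
    ∑ x, ∑ z, ‖A x z‖ ^ 2 = (trace (A * Aᴴ)).re := by
  simp only [trace, diag_apply, mul_apply, conjTranspose_apply, Complex.star_def, Complex.mul_conj,
    Complex.normSq_eq_norm_sq, Complex.re_sum, Complex.ofReal_re]

/-- Up to the factor `√2`, `√(minorSum B)` is the Lorentz length of the pair `(tr (B * Bᴴ), B *
Bᴴ)`. These pairs for `B = A * M k` add up to the pair of `A`. -/
theorem sum_sqrt_minorSum_mul_le {X Y Z κ : Type*} [Fintype X] [Fintype Y] [Fintype Z]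
    [Fintype κ] [DecidableEq Z] (A : Matrix X Z ℂ) (M : κ → Matrix Z Y ℂ)
    (hM : ∑ k, M k * (M k)ᴴ = 1) :
    ∑ k, √(minorSum (A * M k)) ≤ √(minorSum A) := by
  let v : Matrix X X ℂ → EuclideanSpace ℂ (X × X) := fun R => WithLp.toLp 2 fun p => R p.1 p.2
  have hv : ∀ R, ‖v R‖ ^ 2 = ∑ x, ∑ y, ‖R x y‖ ^ 2 := fun R => by
    rw [EuclideanSpace.norm_sq_eq, Fintype.sum_prod_type]
  have hms : ∀ {W : Type _} [Fintype W] (B : Matrix X W ℂ),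
      √(minorSum B) = √2 * √((trace (B * Bᴴ)).re ^ 2 - ‖v (B * Bᴴ)‖ ^ 2) := by
    intro W _ B
    rw [minorSum_eq, hv, ← sum_sum_norm_sq_eq_trace, Real.sqrt_mul zero_le_two]
  -- Each pair lies in the forward cone; this is just `minorSum_nonneg`.
  have hle : ∀ k, ‖v (A * M k * (A * M k)ᴴ)‖ ≤ (trace (A * M k * (A * M k)ᴴ)).re := fun k => by
    have h := minorSum_nonneg (A * M k)
    rw [minorSum_eq, ← hv, sum_sum_norm_sq_eq_trace] at h
    refine le_of_sq_le_sq (by linarith) ?_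
    rw [← sum_sum_norm_sq_eq_trace]
    positivity
  have hsum : ∑ k, A * M k * (A * M k)ᴴ = A * Aᴴ := by
    calc ∑ k, A * M k * (A * M k)ᴴ = A * (∑ k, M k * (M k)ᴴ) * Aᴴ := by
          simp only [conjTranspose_mul, Matrix.mul_sum, Matrix.sum_mul, Matrix.mul_assoc]
      _ = A * Aᴴ := by rw [hM, Matrix.mul_one]
  have hvsum : ∑ k, v (A * M k * (A * M k)ᴴ) = v (A * Aᴴ) := by
    rw [← hsum]
    ext p
    simp [v, Matrix.sum_apply]
  have h := sum_sqrt_sq_sub_norm_sq_le Finset.univ _ _ hle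
  rw [hvsum, ← Complex.re_sum, ← trace_sum, hsum] at h
  rw [hms]
  calc ∑ k, √(minorSum (A * M k)) = √2 * ∑ k, √((trace (A * M k * (A * M k)ᴴ)).re ^ 2
        - ‖v (A * M k * (A * M k)ᴴ)‖ ^ 2) := by
        rw [Finset.mul_sum]
        refine Finset.sum_congr rfl fun k _ => ?_
        rw [minorSum_eq, hv, ← sum_sum_norm_sq_eq_trace, Real.sqrt_mul zero_le_two]
    _ ≤ _ := by gcongr

end GME
end

/-! ### Local operators and LOCC -/

noncomputable section
namespace GME
open Matrix

section localOperators

variable {ι : Type*} [Fintype ι] [DecidableEq ι] {d e : ι → ℕ}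

theorem sum_ite_agree {R : Type*} [AddCommMonoid R] {i : ι} (hde : ∀ j, j ≠ i → e j = d j)
    (x : ∀ j, Fin (d j)) (f : Fin (e i) → R) :
    (∑ z : ∀ j, Fin (e j), if ∀ j, j ≠ i → (z j : ℕ) = (x j : ℕ) then f (z i) else 0) =
      ∑ t, f t := by
  rw [Fintype.sum_equiv (Equiv.piSplitAt i fun j => Fin (e j)) _
    (fun p : Fin (e i) × (∀ j : {j // j ≠ i}, Fin (e j)) =>
      if p.2 = fun j : {j // j ≠ i} => Fin.cast (hde j j.2).symm (x j) then f p.1 else 0)]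
  · rw [Fintype.sum_prod_type]
    simp
  · intro z
    simp only [Equiv.piSplitAt_apply, funext_iff, Subtype.forall, Fin.ext_iff, Fin.val_cast]

/-- The operator acting as `K` on the tensor factor `i` and as the identity on every other factor,
for systems that agree away from `i`. -/
def factorOp (i : ι) (K : Matrix (Fin (e i)) (Fin (d i)) ℂ) :
    Matrix (∀ j, Fin (e j)) (∀ j, Fin (d j)) ℂ :=
  Matrix.of fun x y => if ∀ j, j ≠ i → (x j : ℕ) = (y j : ℕ) then K (x i) (y i) else 0

/-- Tensoring with the identity preserves completeness of a Kraus family. The index type is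
arbitrary so that this applies to the factors outside `S` alone. -/
theorem sum_conjTranspose_factorOp_mul_factorOp {i : ι} (hde : ∀ j, j ≠ i → e j = d j)
    {κ : Type*} [Fintype κ] (K : κ → Matrix (Fin (e i)) (Fin (d i)) ℂ)
    (hK : ∑ k, (K k)ᴴ * K k = 1) :
    ∑ k, (factorOp i (K k))ᴴ * factorOp i (K k) =
      (1 : Matrix (∀ j, Fin (d j)) (∀ j, Fin (d j)) ℂ) := by
  ext x y
  have hxy : ∀ a b, ∑ k, ∑ t, star (K k t a) * K k t b = if a = b then (1 : ℂ) else 0 := by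
    intro a b
    have := congrFun (congrFun hK a) b
    simpa [Matrix.sum_apply, mul_apply, one_apply] using this
  simp only [Matrix.sum_apply, mul_apply, conjTranspose_apply, factorOp, of_apply]
  by_cases h : ∀ j, j ≠ i → (x j : ℕ) = (y j : ℕ)
  · have : ∀ (k : κ) (z : ∀ j, Fin (e j)),
        star (if ∀ j, j ≠ i → (z j : ℕ) = (x j : ℕ) then K k (z i) (x i) else 0) *
          (if ∀ j, j ≠ i → (z j : ℕ) = (y j : ℕ) then K k (z i) (y i) else 0) =
        if ∀ j, j ≠ i → (z j : ℕ) = (x j : ℕ) then star (K k (z i) (x i)) * K k (z i) (y i)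
          else 0 := by
      intro k z
      by_cases hz : ∀ j, j ≠ i → (z j : ℕ) = (x j : ℕ)
      · rw [if_pos hz, if_pos hz, if_pos fun j hj => (hz j hj).trans (h j hj)]
      · rw [if_neg hz, if_neg hz, star_zero, zero_mul]
    simp only [this]
    rw [Finset.sum_congr rfl fun k _ =>
      sum_ite_agree hde x fun t => star (K k t (x i)) * K k t (y i), hxy, one_apply]
    refine if_congr ⟨fun hi => funext fun j => ?_, fun hxy => congrFun hxy i⟩ rfl rfl
    by_cases hj : j = i
    · subst hj; exact hi
    · exact Fin.ext (h j hj)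
  · rw [one_apply, if_neg fun hxy => h fun j _ => by rw [hxy]]
    refine Finset.sum_eq_zero fun k _ => Finset.sum_eq_zero fun z _ => ?_
    by_cases hz : ∀ j, j ≠ i → (z j : ℕ) = (x j : ℕ)
    · rw [if_neg (c := ∀ j, j ≠ i → (z j : ℕ) = (y j : ℕ)), mul_zero]
      exact fun hz' => h fun j hj => (hz j hj).symm.trans (hz' j hj)
    · rw [if_neg hz, star_zero, zero_mul]

end localOperators

variable {N : ℕ} {d e : Fin N → ℕ}

/-- A label of the whole system, split into its parts on `S` and outside `S`. -/
def splitEquiv (d : Fin N → ℕ) (S : Finset (Fin N)) : Idx d ≃ SubIdx d S × CoIdx d S :=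
  Equiv.piEquivPiSubtypeProd (· ∈ S) fun i => Fin (d i)

theorem glue_splitEquiv (S : Finset (Fin N)) (x : Idx d) :
    glue S (splitEquiv d S x).1 (splitEquiv d S x).2 = x :=
  (splitEquiv d S).symm_apply_apply x

/-- The coefficients of `ψ`, as a matrix with rows labelled by `S` and columns by its
complement. -/
def coeffMatrix (ψ : Ket d) (S : Finset (Fin N)) : Matrix (SubIdx d S) (CoIdx d S) ℂ :=
  Matrix.of fun x z => ψ (glue S x z)

theorem partialTrace_density (ψ : Ket d) (S : Finset (Fin N)) :
    partialTrace S (density ψ) = coeffMatrix ψ S * (coeffMatrix ψ S)ᴴ := by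
  ext x y
  simp [partialTrace, density, coeffMatrix, mul_apply]

theorem sum_coeffMatrix (ψ : Ket d) (S : Finset (Fin N)) :
    ∑ x, ∑ z, ‖coeffMatrix ψ S x z‖ ^ 2 = ‖ψ‖ ^ 2 := by
  rw [EuclideanSpace.norm_sq_eq, ← Fintype.sum_prod_type'
    (f := fun x z => ‖coeffMatrix ψ S x z‖ ^ 2)]
  exact Fintype.sum_equiv (splitEquiv d S).symm _ _ fun p => rfl

/-- The concurrence, extended to unnormalized vectors so as to be homogeneous of degree two. -/
def minorNorm (ψ : Ket d) (S : Finset (Fin N)) : ℝ := √(minorSum (coeffMatrix ψ S))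

/-- Normalization is essential: the `1` in the concurrence stands for `‖ψ‖ ^ 4`. -/
theorem concurrence_eq_minorNorm {ψ : Ket d} (hψ : ‖ψ‖ = 1) (S : Finset (Fin N)) :
    concurrence ψ S = minorNorm ψ S := by
  rw [concurrence, minorNorm, partialTrace_density, trace_mul_conjTranspose_sq, minorSum_eq,
    sum_coeffMatrix, hψ]
  norm_num

theorem minorNorm_smul (c : ℂ) (ψ : Ket d) (S : Finset (Fin N)) :
    minorNorm (c • ψ) S = ‖c‖ ^ 2 * minorNorm ψ S := by
  have : coeffMatrix (c • ψ) S = c • coeffMatrix ψ S := by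
    ext x z; simp [coeffMatrix]
  rw [minorNorm, this, minorSum_smul, Real.sqrt_mul (by positivity), minorNorm,
    show ‖c‖ ^ 4 = (‖c‖ ^ 2) ^ 2 by ring, Real.sqrt_sq (by positivity)]

theorem minorNorm_eq_zero_iff (ψ : Ket d) (S : Finset (Fin N)) :
    minorNorm ψ S = 0 ↔ IsProductAcross ψ S := by
  rw [minorNorm, Real.sqrt_eq_zero (minorSum_nonneg _), minorSum_eq_zero_iff]
  constructor
  · rintro ⟨u, v, h⟩
    exact ⟨WithLp.toLp 2 u, WithLp.toLp 2 v, h⟩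
  · rintro ⟨u, v, h⟩
    exact ⟨u, v, h⟩

/-- Exchanging the two sides transposes the coefficient matrix, up to relabelling. -/
theorem minorNorm_compl (ψ : Ket d) (S : Finset (Fin N)) : minorNorm ψ Sᶜ = minorNorm ψ S := by
  let f : SubIdx d Sᶜ ≃ CoIdx d S :=
    { toFun := fun x j => x ⟨j, Finset.mem_compl.2 j.2⟩
      invFun := fun x j => x ⟨j, Finset.mem_compl.1 j.2⟩
      left_inv := fun _ => rfl
      right_inv := fun _ => rfl }
  let g : CoIdx d Sᶜ ≃ SubIdx d S :=
    { toFun := fun x j => x ⟨j, fun h => Finset.mem_compl.1 h j.2⟩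
      invFun := fun x j => x ⟨j, Finset.notMem_compl.1 j.2⟩
      left_inv := fun _ => rfl
      right_inv := fun _ => rfl }
  have : coeffMatrix ψ Sᶜ = (coeffMatrix ψ S)ᵀ.submatrix f g := by
    ext x z
    simp only [coeffMatrix, of_apply, submatrix_apply, transpose_apply]
    refine congrArg ψ (funext fun i => ?_)
    by_cases hi : i ∈ S <;> simp [glue, hi, f, g]
  rw [minorNorm, this, minorSum_reindex, minorSum_transpose, minorNorm]

/-- The action of an operator on vectors. -/
def applyOp (M : Op e d) (ψ : Ket d) : Ket e := WithLp.toLp 2 (M *ᵥ ψ)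

theorem mul_density_mul_conjTranspose (M : Op e d) (ψ : Ket d) :
    M * density ψ * Mᴴ = density (applyOp M ψ) := by
  have h : ∀ {d : Fin N → ℕ} (ψ : Ket d), density ψ = vecMulVec ψ (star (ψ : Idx d → ℂ)) :=
    fun ψ => by ext x y; simp [density, vecMulVec_apply]
  rw [h, h, mul_vecMulVec, vecMulVec_mul, applyOp]
  simp [star_mulVec]

/-- A party outside `S` acts on the column index only, hence by right multiplication. The
relabelling of the rows is the cast along `e j = d j`. -/
theorem coeffMatrix_applyOp_localOp {i : Fin N} (hde : ∀ j, j ≠ i → e j = d j)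
    (K : Matrix (Fin (e i)) (Fin (d i)) ℂ) (ψ : Ket d) {S : Finset (Fin N)} (hi : i ∉ S) :
    coeffMatrix (applyOp (localOp i K) ψ) S =
      ((coeffMatrix ψ S) * (factorOp (d := fun j : {j // j ∉ S} => d j)
        (e := fun j : {j // j ∉ S} => e j) ⟨i, hi⟩ K)ᵀ).submatrix
        (Equiv.piCongrRight fun j : {j // j ∈ S} =>
          finCongr (hde j fun h => hi (h ▸ j.2))) id := by
  ext x z
  simp only [coeffMatrix, of_apply, submatrix_apply, mul_apply, transpose_apply, applyOp, id,
    mulVec, dotProduct]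
  rw [Fintype.sum_equiv (splitEquiv d S) _
    (fun p => localOp i K (glue S x z) (glue S p.1 p.2) * ψ (glue S p.1 p.2))
    (fun y => by rw [glue_splitEquiv]), Fintype.sum_prod_type,
    -- The operator is the identity on `S`, so only the row label that copies `x` contributes.
    Finset.sum_eq_single (Equiv.piCongrRight (fun j : {j // j ∈ S} =>
          finCongr (hde j fun h => hi (h ▸ j.2))) x)]
  · refine Finset.sum_congr rfl fun w _ => ?_
    rw [mul_comm]
    congr 1
    simp only [localOp, factorOp, of_apply]
    refine if_congr ?_ (by simp [glue, hi]) rfl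
    constructor
    · intro h j hj
      have := h j fun h => hj (Subtype.ext h)
      simpa [glue, j.2] using this
    · intro h j hj
      by_cases hjS : j ∈ S
      · simp [glue, hjS]
      · have := h ⟨j, hjS⟩ fun h => hj (congrArg Subtype.val h)
        simpa [glue, hjS] using this
  · intro y _ hy
    refine Finset.sum_eq_zero fun w _ => ?_
    rw [localOp, of_apply, if_neg, zero_mul]
    intro h
    apply hy
    funext j
    have := h j fun h => hi (h ▸ j.2)
    simp only [glue, j.2, dif_pos] at this
    exact Fin.ext this.symm
  · simp

theorem sum_minorNorm_localOp_le_of_notMem {i : Fin N} (hde : ∀ j, j ≠ i → e j = d j)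
    {κ : Type*} [Fintype κ] (K : κ → Matrix (Fin (e i)) (Fin (d i)) ℂ)
    (hK : ∑ k, (K k)ᴴ * K k = 1) (ψ : Ket d) {S : Finset (Fin N)} (hi : i ∉ S) :
    ∑ k, minorNorm (applyOp (localOp i (K k)) ψ) S ≤ minorNorm ψ S := by
  have h := sum_conjTranspose_factorOp_mul_factorOp (ι := {j // j ∉ S})
    (d := fun j => d j) (e := fun j => e j) (i := ⟨i, hi⟩)
    (fun j hj => hde j fun h => hj (Subtype.ext h)) K hK
  have h' := sum_sqrt_minorSum_mul_le (coeffMatrix ψ S)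
    (fun k => (factorOp (d := fun j : {j // j ∉ S} => d j)
        (e := fun j : {j // j ∉ S} => e j) ⟨i, hi⟩ (K k))ᵀ) (by
      -- Transposing `∑ Fᴴ * F = 1` gives `∑ M * Mᴴ = 1` for `M = Fᵀ`.
      have := congrArg transpose h
      rw [transpose_sum, transpose_one] at this
      rw [← this]
      refine Finset.sum_congr rfl fun k _ => ?_
      rw [transpose_mul]
      rfl)
  refine le_trans (le_of_eq (Finset.sum_congr rfl fun k _ => ?_)) h'
  rw [minorNorm, coeffMatrix_applyOp_localOp hde _ _ hi]
  exact congrArg _ (minorSum_reindex _ _ (Equiv.refl _))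

theorem sum_minorNorm_localOp_le {i : Fin N} (hde : ∀ j, j ≠ i → e j = d j)
    {κ : Type*} [Fintype κ] (K : κ → Matrix (Fin (e i)) (Fin (d i)) ℂ)
    (hK : ∑ k, (K k)ᴴ * K k = 1) (ψ : Ket d) (S : Finset (Fin N)) :
    ∑ k, minorNorm (applyOp (localOp i (K k)) ψ) S ≤ minorNorm ψ S := by
  by_cases hi : i ∈ S
  · have := sum_minorNorm_localOp_le_of_notMem hde K hK ψ (S := Sᶜ) (Finset.notMem_compl.2 hi)
    simpa only [minorNorm_compl] using this
  · exact sum_minorNorm_localOp_le_of_notMem hde K hK ψ hi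

/-- An LOCC map sends a pure state to a mixture whose average concurrences are no larger. -/
theorem IsLOCC.exists_ensemble {d' : Fin N → ℕ} {Λ : Op d d → Op d' d'} (hΛ : IsLOCC d' d Λ)
    (ψ : Ket d) : ∃ (n : ℕ) (φ : Fin n → Ket d'), Λ (density ψ) = ∑ b, density (φ b) ∧
      ∀ S, ∑ b, minorNorm (φ b) S ≤ minorNorm ψ S := by
  induction hΛ with
  | done => exact ⟨1, fun _ => ψ, by simp, by simp⟩
  | step i hde K hK Λ _ ih =>
    -- The branch vectors stay unnormalized: their squared norms carry the outcome probabilities, so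
    -- no weights appear in the averages.
    choose n φ hφ hle using fun k => ih k (applyOp (localOp i (K k)) ψ)
    have hsum : ∀ {M : Type} [AddCommMonoid M] (f : Ket d' → M),
        ∑ b, f (φ (finSigmaFinEquiv.symm b).1 (finSigmaFinEquiv.symm b).2) =
          ∑ k, ∑ b, f (φ k b) := fun f => by
      rw [Fintype.sum_equiv finSigmaFinEquiv.symm _ (fun p => f (φ p.1 p.2)) fun _ => rfl,
        Fintype.sum_sigma]
    refine ⟨_, fun b => φ (finSigmaFinEquiv.symm b).1 (finSigmaFinEquiv.symm b).2, ?_, ?_⟩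
    · rw [hsum density]
      exact Finset.sum_congr rfl fun k _ => by rw [mul_density_mul_conjTranspose, hφ]
    · intro S
      rw [hsum fun χ => minorNorm χ S]
      exact (Finset.sum_le_sum fun k _ => hle k S).trans (sum_minorNorm_localOp_le hde K hK ψ S)

/-! ### Rigidity of pure states and biseparability -/

theorem dotProduct_density_mulVec (ψ v : Ket d) :
    star (v : Idx d → ℂ) ⬝ᵥ density ψ *ᵥ (v : Idx d → ℂ) = (‖inner ℂ v ψ‖ ^ 2 : ℝ) := by
  have h : density ψ = vecMulVec ψ (star (ψ : Idx d → ℂ)) := by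
    ext x y; simp [density, vecMulVec_apply]
  rw [h, vecMulVec_mulVec, dotProduct_smul, ← Complex.normSq_eq_norm_sq, ← Complex.mul_conj,
    inner_conj_symm, EuclideanSpace.inner_eq_star_dotProduct,
    EuclideanSpace.inner_eq_star_dotProduct, dotProduct_comm]
  simp [mul_comm, dotProduct_comm]

/-- A pure state is a mixture only of multiples of itself. -/
theorem exists_smul_of_density_eq_sum {κ : Type*} [Fintype κ] {ψ : Ket d} (hψ : ‖ψ‖ = 1)
    (φ : κ → Ket d) (h : density ψ = ∑ k, density (φ k)) :
    ∃ c : κ → ℂ, (∀ k, φ k = c k • ψ) ∧ ∑ k, ‖c k‖ ^ 2 = 1 := by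
  have key : ∀ v : Ket d, ‖inner ℂ v ψ‖ ^ 2 = ∑ k, ‖inner ℂ v (φ k)‖ ^ 2 := fun v => by
    have := dotProduct_density_mulVec ψ v
    rw [h, sum_mulVec, dotProduct_sum] at this
    simp only [dotProduct_density_mulVec] at this
    exact_mod_cast this.symm
  refine ⟨fun k => inner ℂ ψ (φ k), fun k => ?_, ?_⟩
  · have h0 : inner ℂ (φ k - inner ℂ ψ (φ k) • ψ) ψ = 0 := by
      rw [inner_sub_left, inner_smul_left, inner_self_eq_norm_sq_to_K, hψ]
      simp
    -- Test with the component of `φ k` orthogonal to `ψ`: the left side vanishes, hence so does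
    -- every nonnegative term on the right.
    have h1 := key (φ k - inner ℂ ψ (φ k) • ψ)
    rw [h0, norm_zero, zero_pow two_ne_zero, eq_comm,
      Finset.sum_eq_zero_iff_of_nonneg fun _ _ => by positivity] at h1
    have h2 : inner ℂ (φ k - inner ℂ ψ (φ k) • ψ) (φ k) = 0 := by
      simpa using h1 k (Finset.mem_univ _)
    rw [← sub_eq_zero, ← inner_self_eq_zero (𝕜 := ℂ), inner_sub_right, h2, inner_smul_right, h0]
    simp
  · rw [← key, inner_self_eq_norm_sq_to_K, hψ]
    simp

theorem IsLOCC.concurrence_le {d' : Fin N → ℕ} {Λ : Op d d → Op d' d'} (hΛ : IsLOCC d' d Λ)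
    {ψ : Ket d} {φ : Ket d'} (hψ : ‖ψ‖ = 1) (hφ : ‖φ‖ = 1) (h : Λ (density ψ) = density φ)
    (S : Finset (Fin N)) : concurrence φ S ≤ concurrence ψ S := by
  obtain ⟨n, χ, hχ, hle⟩ := hΛ.exists_ensemble ψ
  obtain ⟨c, hc, hc1⟩ := exists_smul_of_density_eq_sum hφ χ (h.symm.trans hχ)
  have := hle S
  simp only [hc, minorNorm_smul, ← Finset.sum_mul, hc1, one_mul] at this
  rwa [concurrence_eq_minorNorm hψ, concurrence_eq_minorNorm hφ]

theorem IsProductAcross.smul {ψ : Ket d} {S : Finset (Fin N)} (h : IsProductAcross ψ S) (c : ℂ) :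
    IsProductAcross (c • ψ) S := by
  rw [← minorNorm_eq_zero_iff] at h ⊢
  rw [minorNorm_smul, h, mul_zero]

theorem isBiseparable_density_iff {ψ : Ket d} (hψ : ‖ψ‖ = 1) :
    IsBiseparable (density ψ) ↔ IsProductAcrossSome ψ := by
  refine ⟨fun h => ?_, fun h => subset_convexHull _ _ ⟨ψ, hψ, h, rfl⟩⟩
  rw [IsBiseparable, mem_convexHull_iff_exists_fintype] at h
  obtain ⟨κ, _, w, σ, hw, hw1, hσ, hsum⟩ := h
  choose φ hφ1 hφ hφσ using hσ
  have hd : density ψ = ∑ k, density (((√(w k) : ℝ) : ℂ) • φ k) := by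
    rw [← hsum]
    refine Finset.sum_congr rfl fun k _ => ?_
    ext x y
    have : ((w k : ℝ) : ℂ) = (√(w k) : ℝ) * (√(w k) : ℝ) := by
      rw [← Complex.ofReal_mul, Real.mul_self_sqrt (hw k)]
    simp only [hφσ, density, Matrix.smul_apply, of_apply, PiLp.smul_apply, smul_eq_mul,
      Complex.real_smul, this, star_mul', Complex.star_def, Complex.conj_ofReal]
    ring
  obtain ⟨c, hc, hc1⟩ := exists_smul_of_density_eq_sum hψ _ hd
  -- A single term with nonzero coefficient suffices: `ψ` is then a multiple of the product vector
  -- `φ k`.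
  obtain ⟨k, hk⟩ : ∃ k, c k ≠ 0 := by
    by_contra! h0
    simp [h0] at hc1
  obtain ⟨S, hS, hS', hprod⟩ := hφ k
  refine ⟨S, hS, hS', ?_⟩
  have : ψ = (c k)⁻¹ • (((√(w k) : ℝ) : ℂ) • φ k) := by rw [hc, inv_smul_smul₀ hk]
  rw [this]
  exact (hprod.smul _).smul _

end GME
end

/-! ### Area of the regular polygon and volume of the pyramid -/

noncomputable section
namespace GME
open MeasureTheory
open scoped Pointwise

/-- The side `re = 0` is left out so that the rotated images of the triangle are disjoint. -/
theorem volume_half_open_triangle :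
    volume {z : ℂ | 0 < z.re ∧ 0 ≤ z.im ∧ z.re + z.im ≤ 1} = ENNReal.ofReal (1 / 2) := by
  have hm : MeasurableSet {p : ℝ × ℝ | 0 < p.1 ∧ 0 ≤ p.2 ∧ p.1 + p.2 ≤ 1} :=
    (measurableSet_lt measurable_const measurable_fst).inter
      ((measurableSet_le measurable_const measurable_snd).inter
        (measurableSet_le (measurable_fst.add measurable_snd) measurable_const))
  have hpre : {z : ℂ | 0 < z.re ∧ 0 ≤ z.im ∧ z.re + z.im ≤ 1} = Complex.measurableEquivRealProd ⁻¹'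
      {p : ℝ × ℝ | 0 < p.1 ∧ 0 ≤ p.2 ∧ p.1 + p.2 ≤ 1} := rfl
  rw [hpre, Complex.volume_preserving_equiv_real_prod.measure_preimage hm.nullMeasurableSet,
    Measure.volume_eq_prod, Measure.prod_apply_symm hm]
  have hslice : ∀ y : ℝ, volume ((fun x : ℝ => (x, y)) ⁻¹'
      {p : ℝ × ℝ | 0 < p.1 ∧ 0 ≤ p.2 ∧ p.1 + p.2 ≤ 1}) =
        (Set.Icc (0 : ℝ) 1).indicator (fun y => ENNReal.ofReal (1 - y)) y := fun y => by
    by_cases hy : y ∈ Set.Icc (0 : ℝ) 1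
    · rw [Set.indicator_of_mem hy, show (fun x : ℝ => (x, y)) ⁻¹'
        {p : ℝ × ℝ | 0 < p.1 ∧ 0 ≤ p.2 ∧ p.1 + p.2 ≤ 1} = Set.Ioc 0 (1 - y) by
          ext x
          simp only [Set.mem_preimage, Set.mem_ofPred_eq, Set.mem_Ioc, hy.1, true_and,
            le_sub_iff_add_le], Real.volume_Ioc, sub_zero]
    · rw [Set.indicator_of_notMem hy, show (fun x : ℝ => (x, y)) ⁻¹'
        {p : ℝ × ℝ | 0 < p.1 ∧ 0 ≤ p.2 ∧ p.1 + p.2 ≤ 1} = ∅ by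
          refine Set.eq_empty_of_forall_notMem fun x hx => hy ⟨hx.2.1, ?_⟩
          linarith [hx.1, hx.2.2], measure_empty]
  simp only [hslice]
  rw [lintegral_indicator measurableSet_Icc, ← ofReal_integral_eq_lintegral_ofReal]
  · rw [integral_Icc_eq_integral_Ioc, ← intervalIntegral.integral_of_le zero_le_one]
    rw [intervalIntegral.integral_sub intervalIntegrable_const intervalIntegral.intervalIntegrable_id,
      intervalIntegral.integral_const, integral_id]
    norm_num
  · exact (continuous_const.sub continuous_id).integrableOn_Icc
  · exact ae_restrict_of_forall_mem measurableSet_Icc fun y hy => sub_nonneg.2 hy.2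

/-- The regular `N`-gon inscribed in the unit circle. -/
def unitPolygon (N : ℕ) : Set ℂ :=
  convexHull ℝ (Set.range fun k : Fin N =>
    Complex.exp ((2 * Real.pi * ((k : ℕ) : ℝ) / (N : ℝ) : ℝ) * Complex.I))

/-- The points of positive modulus and of argument in `[0, φ)`. -/
def sector (φ : ℝ) : Set ℂ := {z | z ≠ 0 ∧ 0 ≤ z.arg ∧ z.arg < φ}

theorem measurableSet_sector (φ : ℝ) : MeasurableSet (sector φ) :=
  (measurableSet_singleton (0 : ℂ)).compl.inter
    ((measurableSet_le measurable_const Complex.measurable_arg).inter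
      (measurableSet_lt Complex.measurable_arg measurable_const))

/-- As the set of `N`-th roots of unity, the vertices are visibly stable under multiplication by
such roots. -/
theorem range_exp_eq_nthRoots {N : ℕ} (hN : N ≠ 0) :
    (Set.range fun k : Fin N =>
      Complex.exp ((2 * Real.pi * ((k : ℕ) : ℝ) / (N : ℝ) : ℝ) * Complex.I)) =
      {z : ℂ | z ^ N = 1} := by
  have : NeZero N := ⟨hN⟩
  have hexp : ∀ k : ℕ, Complex.exp ((2 * Real.pi * (k : ℝ) / (N : ℝ) : ℝ) * Complex.I) =
      Complex.exp (2 * Real.pi * Complex.I / N) ^ k := fun k => by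
    rw [← Complex.exp_nat_mul]
    congr 1
    push_cast
    ring
  have hprim := Complex.isPrimitiveRoot_exp N hN
  ext z
  simp only [Set.mem_range, Set.mem_ofPred_eq, hexp]
  constructor
  · rintro ⟨k, rfl⟩
    rw [pow_right_comm, hprim.pow_eq_one, one_pow]
  · intro h
    obtain ⟨k, hk, rfl⟩ := hprim.eq_pow_of_pow_eq_one h
    exact ⟨⟨k, hk⟩, rfl⟩

theorem mul_mem_unitPolygon {N : ℕ} (hN : N ≠ 0) {u z : ℂ} (hu : u ^ N = 1)
    (hz : z ∈ unitPolygon N) : u * z ∈ unitPolygon N := by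
  rw [unitPolygon, range_exp_eq_nthRoots hN] at hz ⊢
  have := Set.mem_image_of_mem (LinearMap.mulLeft ℝ u) hz
  rw [LinearMap.image_convexHull] at this
  refine convexHull_mono ?_ this
  rintro _ ⟨v, hv, rfl⟩
  simp only [Set.mem_ofPred_eq, LinearMap.mulLeft_apply] at hv ⊢
  rw [mul_pow, hu, hv, one_mul]

theorem isClosed_unitPolygon (N : ℕ) : IsClosed (unitPolygon N) :=
  (Set.finite_range _).isClosed_convexHull ℝ

theorem zero_mem_unitPolygon {N : ℕ} (hN : 1 < N) : (0 : ℂ) ∈ unitPolygon N := by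
  have : NeZero N := ⟨by omega⟩
  have hprim := Complex.isPrimitiveRoot_exp N (by omega)
  have hsum := hprim.geom_sum_eq_zero hN
  have hmem : ∑ k ∈ Finset.range N, (1 / N : ℝ) • Complex.exp (2 * Real.pi * Complex.I / N) ^ k ∈
      unitPolygon N := by
    refine (convex_convexHull ℝ _).sum_mem (fun _ _ => by positivity) ?_ fun k _ => ?_
    · simp [NeZero.ne N]
    · refine subset_convexHull ℝ _ ?_
      rw [range_exp_eq_nthRoots (NeZero.ne N)]
      simp only [Set.mem_ofPred_eq]
      rw [pow_right_comm, hprim.pow_eq_one, one_pow]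
  rwa [← Finset.smul_sum, hsum, smul_zero] at hmem

/-- This is the supporting half-plane of the edge from `1` to `exp (2πi / N)`, whose normal has
angle `π / N`. -/
theorem re_cos_add_im_sin_le_of_mem_unitPolygon {N : ℕ} {z : ℂ}
    (hz : z ∈ unitPolygon N) :
    z.re * Real.cos (Real.pi / N) + z.im * Real.sin (Real.pi / N) ≤ Real.cos (Real.pi / N) := by
  have hlin : IsLinearMap ℝ fun z : ℂ =>
      z.re * Real.cos (Real.pi / N) + z.im * Real.sin (Real.pi / N) :=
    ⟨fun z w => by simp only [Complex.add_re, Complex.add_im]; ring,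
      fun c z => by simp only [Complex.real_smul, Complex.re_ofReal_mul, Complex.im_ofReal_mul,
        smul_eq_mul]; ring⟩
  refine convexHull_min ?_ (convex_halfSpace_le hlin _) hz
  rintro _ ⟨k, rfl⟩
  have hN : 0 < N := k.pos
  have hN' : (0 : ℝ) < N := by exact_mod_cast hN
  simp only [Set.mem_ofPred_eq, Complex.exp_ofReal_mul_I_re, Complex.exp_ofReal_mul_I_im]
  rw [← Real.cos_sub, ← sub_nonneg, Real.cos_sub_cos,
    show (Real.pi / N + (2 * Real.pi * ((k : ℕ) : ℝ) / N - Real.pi / N)) / 2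
      = (k : ℕ) * (Real.pi / N) by ring,
    show (Real.pi / N - (2 * Real.pi * ((k : ℕ) : ℝ) / N - Real.pi / N)) / 2
      = -(((k : ℕ) - 1) * (Real.pi / N)) by ring, Real.sin_neg]
  have hk : ((k : ℕ) : ℝ) + 1 ≤ N := by exact_mod_cast k.2
  have hmul : ∀ x : ℝ, x ≤ N → x * (Real.pi / N) ≤ Real.pi := fun x hx => by
    rw [← mul_div_assoc, div_le_iff₀ hN', mul_comm]
    exact mul_le_mul_of_nonneg_left hx Real.pi_pos.le
  -- The claim is now that `sin (k π / N) * sin ((k - 1) π / N)` is nonnegative; at `k = 0` the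
  -- second factor is negative but the first is zero.
  rcases Nat.eq_zero_or_pos (k : ℕ) with h0 | h0
  · simp [h0]
  · have h1 : (1 : ℝ) ≤ (k : ℕ) := by exact_mod_cast h0
    have hs1 := Real.sin_nonneg_of_nonneg_of_le_pi
      (x := (k : ℕ) * (Real.pi / N)) (by positivity) (hmul _ (by linarith))
    have hs2 := Real.sin_nonneg_of_nonneg_of_le_pi (x := ((k : ℕ) - 1) * (Real.pi / N))
      (mul_nonneg (by linarith) (by positivity)) (hmul _ (by linarith))
    nlinarith [mul_nonneg hs1 hs2]

/-- The linear map sending `1` to `1` and `I` to `exp (φ * I)`. -/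
def sectorMap (φ : ℝ) : ℂ →ₗ[ℝ] ℂ :=
  Matrix.toLin Complex.basisOneI Complex.basisOneI !![1, Real.cos φ; 0, Real.sin φ]

theorem det_sectorMap (φ : ℝ) : LinearMap.det (sectorMap φ) = Real.sin φ := by
  rw [sectorMap, LinearMap.det_toLin]
  simp

theorem sectorMap_apply (φ : ℝ) (z : ℂ) :
    sectorMap φ z = ⟨z.re + z.im * Real.cos φ, z.im * Real.sin φ⟩ := by
  rw [sectorMap, Matrix.toLin_apply]
  apply Complex.ext
  · simp [Fin.sum_univ_two, Matrix.mulVec, dotProduct, mul_comm, Complex.cos_ofReal_re]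
  · simp [Fin.sum_univ_two, Matrix.mulVec, dotProduct, mul_comm, Complex.sin_ofReal_re]

/-- The edge inequality bounds this piece from outside; convexity, with the centre and two adjacent
vertices, fills it from inside. -/
theorem unitPolygon_inter_sector {N : ℕ} (hN : 2 < N) :
    unitPolygon N ∩ sector (2 * Real.pi / N) =
      sectorMap (2 * Real.pi / N) '' {z : ℂ | 0 < z.re ∧ 0 ≤ z.im ∧ z.re + z.im ≤ 1} := by
  have hN' : (3 : ℝ) ≤ N := by exact_mod_cast hN
  have hpi := Real.pi_pos
  have hα : Real.pi / N ≤ Real.pi / 3 := by gcongr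
  have hα0 : 0 < Real.pi / N := by positivity
  rw [mul_div_assoc]
  set α := Real.pi / N with hαdef
  have hc : 0 < Real.cos α := Real.cos_pos_of_mem_Ioo ⟨by linarith, by linarith⟩
  have hs : 0 < Real.sin (2 * α) := Real.sin_pos_of_pos_of_lt_pi (by linarith) (by linarith)
  have hadd : Real.cos (2 * α) * Real.cos α + Real.sin (2 * α) * Real.sin α = Real.cos α := by
    rw [← Real.cos_sub]; congr 1; ring
  ext z
  constructor
  · rintro ⟨hz, hz0, harg0, harg⟩
    have hzn : 0 < ‖z‖ := norm_pos_iff.2 hz0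
    have hre : z.re = ‖z‖ * Real.cos z.arg := (Complex.norm_mul_cos_arg z).symm
    have him : z.im = ‖z‖ * Real.sin z.arg := (Complex.norm_mul_sin_arg z).symm
    have hs1 : 0 < Real.sin (2 * α - z.arg) :=
      Real.sin_pos_of_pos_of_lt_pi (by linarith) (by linarith)
    have hs2 : 0 ≤ Real.sin z.arg := Real.sin_nonneg_of_nonneg_of_le_pi harg0 (by linarith)
    have h1 : z.re = (z.re - z.im / Real.sin (2 * α) * Real.cos (2 * α)) +
      z.im / Real.sin (2 * α) * Real.cos (2 * α) := by ring
    have h2 : z.im = z.im / Real.sin (2 * α) * Real.sin (2 * α) := by field_simp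
    -- The coordinates of `z` in the basis `1`, `exp (2αi)`.
    refine ⟨⟨z.re - z.im / Real.sin (2 * α) * Real.cos (2 * α), z.im / Real.sin (2 * α)⟩,
      ⟨?_, ?_, ?_⟩, ?_⟩
    · have : z.re - z.im / Real.sin (2 * α) * Real.cos (2 * α) =
          ‖z‖ * Real.sin (2 * α - z.arg) / Real.sin (2 * α) := by
        rw [Real.sin_sub, hre, him]
        field_simp
      simp only [this]
      positivity
    · simp only [him]
      positivity
    · have := re_cos_add_im_sin_le_of_mem_unitPolygon hz
      rw [← hαdef] at this
      simp only
      refine le_of_mul_le_mul_right ?_ hc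
      generalize z.im / Real.sin (2 * α) = t at *
      rw [h1] at this
      rw [h2] at this
      linear_combination this - t * hadd
    · rw [sectorMap_apply]
      exact Complex.ext h1.symm h2.symm
  · rintro ⟨w, ⟨hw1, hw2, hw3⟩, rfl⟩
    refine ⟨?_, ?_⟩
    · have hω : ∀ k : ℕ, k < N → Complex.exp ((k * (2 * α) : ℝ) * Complex.I) ∈ unitPolygon N :=
        fun k hk => subset_convexHull ℝ _ ⟨⟨k, hk⟩, by
          simp only [hαdef]; congr 2; push_cast; ring⟩
      have h0 := zero_mem_unitPolygon (N := N) (by omega)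
      have h1 := hω 0 (by omega)
      have h2 := hω 1 (by omega)
      have := (convex_convexHull ℝ _).sum_mem (t := Finset.univ (α := Fin 3))
        (w := ![1 - w.re - w.im, w.re, w.im]) (z := ![0, Complex.exp (((0 : ℕ) * (2 * α) : ℝ) *
          Complex.I), Complex.exp (((1 : ℕ) * (2 * α) : ℝ) * Complex.I)])
        (by intro i _; fin_cases i <;> simp <;> linarith)
        (by simp [Fin.sum_univ_three]; ring) (by intro i _; fin_cases i; exacts [h0, h1, h2])
      rw [Fin.sum_univ_three] at this
      refine Set.mem_of_eq_of_mem ?_ this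
      rw [sectorMap_apply]
      apply Complex.ext <;> simp [Complex.exp_re, Complex.exp_im]
    · rw [sectorMap_apply]
      set z : ℂ := ⟨w.re + w.im * Real.cos (2 * α), w.im * Real.sin (2 * α)⟩ with hzdef
      have hz0 : z ≠ 0 := by
        intro h
        have him : w.im * Real.sin (2 * α) = 0 := congrArg Complex.im h
        have hre : w.re + w.im * Real.cos (2 * α) = 0 := congrArg Complex.re h
        rw [mul_eq_zero, or_iff_left hs.ne'] at him
        rw [him] at hre
        linarith
      have h0 : 0 ≤ z.arg := Complex.arg_nonneg_iff.2 (mul_nonneg hw2 hs.le)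
      refine ⟨hz0, h0, ?_⟩
      by_contra! hle
      have h1 : 0 ≤ Real.sin (z.arg - 2 * α) := Real.sin_nonneg_of_nonneg_of_le_pi (by linarith)
        (by linarith [Complex.arg_le_pi z])
      have h2 := mul_nonneg (norm_nonneg z) h1
      rw [Real.sin_sub, mul_sub, ← mul_assoc, ← mul_assoc, Complex.norm_mul_sin_arg,
        Complex.norm_mul_cos_arg] at h2
      simp only [hzdef] at h2
      nlinarith

theorem mem_sector_iff {φ : ℝ} (hφ : φ < Real.pi) {z : ℂ} :
    z ∈ sector φ ↔ ∃ r θ : ℝ, 0 < r ∧ 0 ≤ θ ∧ θ < φ ∧ z = r * Complex.exp (θ * Complex.I) := by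
  constructor
  · rintro ⟨h0, h1, h2⟩
    exact ⟨‖z‖, z.arg, norm_pos_iff.2 h0, h1, h2, (Complex.norm_mul_exp_arg_mul_I z).symm⟩
  · rintro ⟨r, θ, hr, h1, h2, rfl⟩
    have harg : (r * Complex.exp (θ * Complex.I)).arg = θ := by
      rw [Complex.arg_real_mul _ hr, Complex.arg_exp_mul_I, toIocMod_eq_self]
      constructor <;> linarith [Real.pi_pos]
    exact ⟨mul_ne_zero (Complex.ofReal_ne_zero.2 hr.ne') (Complex.exp_ne_zero _),
      harg.symm ▸ h1, harg.symm ▸ h2⟩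

theorem exists_rotation_mem_sector {N : ℕ} (hN : 2 < N) {z : ℂ} (hz : z ≠ 0) :
    ∃ k < N, Complex.exp ((-(k * (2 * Real.pi / N)) : ℝ) * Complex.I) * z ∈
      sector (2 * Real.pi / N) := by
  have hN' : (3 : ℝ) ≤ N := by exact_mod_cast hN
  have hN0 : (0 : ℝ) < N := by linarith
  have hpi := Real.pi_pos
  have hφ : 2 * Real.pi / N < Real.pi := by
    rw [div_lt_iff₀ hN0]; nlinarith
  have hφ0 : 0 < 2 * Real.pi / N := by positivity
  have hNφ : N * (2 * Real.pi / N) = 2 * Real.pi := by field_simp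
  -- The argument is moved to `[0, 2π)`, so that the number of whole sectors below it is less than
  -- `N`.
  obtain ⟨θ, h0, h1, h⟩ : ∃ θ : ℝ, 0 ≤ θ ∧ θ < 2 * Real.pi ∧
      z = ‖z‖ * Complex.exp (θ * Complex.I) := by
    rcases le_or_gt 0 z.arg with h | h
    · exact ⟨z.arg, h, by linarith [Complex.arg_le_pi z], (Complex.norm_mul_exp_arg_mul_I z).symm⟩
    · refine ⟨z.arg + 2 * Real.pi, by linarith [Complex.neg_pi_lt_arg z], by linarith, ?_⟩
      push_cast
      rw [add_mul, Complex.exp_add, Complex.exp_two_pi_mul_I, mul_one,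
        Complex.norm_mul_exp_arg_mul_I]
  set φ := 2 * Real.pi / N
  have hfl : (⌊θ / φ⌋₊ : ℝ) * φ ≤ θ := (le_div_iff₀ hφ0).1 (Nat.floor_le (by positivity))
  have hfu : θ < (⌊θ / φ⌋₊ + 1 : ℝ) * φ := (div_lt_iff₀ hφ0).1 (Nat.lt_floor_add_one _)
  refine ⟨⌊θ / φ⌋₊, ?_, (mem_sector_iff hφ).2
    ⟨‖z‖, θ - ⌊θ / φ⌋₊ * φ, norm_pos_iff.2 hz, by linarith, by linarith, ?_⟩⟩
  · rw [Nat.floor_lt (by positivity), div_lt_iff₀ hφ0, hNφ]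
    exact h1
  · conv_lhs => rw [h]
    rw [mul_left_comm, ← Complex.exp_add]
    congr 2
    push_cast
    ring

theorem eq_of_rotation_mem_sector {N : ℕ} (hN : 2 < N) {z : ℂ} {j k : ℕ} (hj : j < N) (hk : k < N)
    (hzj : Complex.exp ((-(j * (2 * Real.pi / N)) : ℝ) * Complex.I) * z ∈
      sector (2 * Real.pi / N))
    (hzk : Complex.exp ((-(k * (2 * Real.pi / N)) : ℝ) * Complex.I) * z ∈
      sector (2 * Real.pi / N)) : j = k := by
  have hN' : (3 : ℝ) ≤ N := by exact_mod_cast hN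
  have hN0 : (0 : ℝ) < N := by linarith
  have hpi := Real.pi_pos
  have hφ : 2 * Real.pi / N < Real.pi := by
    rw [div_lt_iff₀ hN0]; nlinarith
  have hφ0 : 0 < 2 * Real.pi / N := by positivity
  have hNφ : N * (2 * Real.pi / N) = 2 * Real.pi := by field_simp
  rw [mem_sector_iff hφ] at hzj hzk
  set φ := 2 * Real.pi / N
  have polar : ∀ {k : ℕ} {r θ : ℝ}, 0 < r →
      Complex.exp ((-(k * φ) : ℝ) * Complex.I) * z = r * Complex.exp (θ * Complex.I) →
      z = ‖z‖ * Complex.exp ((θ + k * φ : ℝ) * Complex.I) := by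
    intro k r θ hr h
    have hnorm : ‖z‖ = r := by
      have := congrArg norm h
      rwa [norm_mul, norm_mul, Complex.norm_exp_ofReal_mul_I, Complex.norm_exp_ofReal_mul_I,
        one_mul, mul_one, Complex.norm_of_nonneg hr.le] at this
    have : z = Complex.exp ((k * φ : ℝ) * Complex.I) *
        (Complex.exp ((-(k * φ) : ℝ) * Complex.I) * z) := by
      rw [← mul_assoc, ← Complex.exp_add]
      simp
    rw [hnorm]
    refine this.trans ?_
    rw [h, mul_left_comm, ← Complex.exp_add]
    congr 2
    push_cast
    ring
  have bound : ∀ {k : ℕ} {θ : ℝ}, k < N → 0 ≤ θ → θ < φ → θ + k * φ < 2 * Real.pi := by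
    intro k θ hk _ h
    have : (k : ℝ) + 1 ≤ N := by exact_mod_cast hk
    nlinarith
  obtain ⟨r, θ, hr, h0, h1, h⟩ := hzj
  obtain ⟨r', θ', hr', h0', h1', h'⟩ := hzk
  have hz : (‖z‖ : ℂ) ≠ 0 := by
    rw [Ne, Complex.ofReal_eq_zero, norm_eq_zero]
    rintro rfl
    rw [mul_zero, eq_comm, mul_eq_zero, Complex.ofReal_eq_zero] at h
    exact h.elim hr.ne' (Complex.exp_ne_zero _)
  have heq := mul_left_cancel₀ hz ((polar hr h).symm.trans (polar hr' h'))
  rw [Complex.exp_eq_exp_iff_exists_int] at heq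
  obtain ⟨n, hn⟩ := heq
  have hn' : θ + j * φ = θ' + k * φ + n * (2 * Real.pi) := by
    have := congrArg Complex.im hn
    simpa using this
  have hb := bound hj h0 h1
  have hb' := bound hk h0' h1'
  have hp : 0 ≤ (j : ℝ) * φ := by positivity
  have hp' : 0 ≤ (k : ℝ) * φ := by positivity
  -- Both angles lie in `[0, 2π)`, so they cannot differ by a nonzero multiple of `2π`.
  have hn0 : n = 0 := by
    have h1 : n < 1 := by
      by_contra! hge
      have : (1 : ℝ) ≤ n := by exact_mod_cast hge
      nlinarith
    have h2 : -1 < n := by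
      by_contra! hge
      have : (n : ℝ) ≤ -1 := by exact_mod_cast hge
      nlinarith
    omega
  rw [hn0] at hn'
  simp only [Int.cast_zero, zero_mul, add_zero] at hn'
  have hjk : (j : ℝ) < k + 1 := by
    by_contra! hge; nlinarith
  have hkj : (k : ℝ) < j + 1 := by
    by_contra! hge; nlinarith
  have hjk : j < k + 1 := by exact_mod_cast hjk
  have hkj : k < j + 1 := by exact_mod_cast hkj
  omega

theorem volume_unitPolygon {N : ℕ} (hN : 2 < N) :
    volume (unitPolygon N) = ENNReal.ofReal (N * Real.sin (2 * Real.pi / N) / 2) := by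
  have hN0 : N ≠ 0 := by omega
  have hN' : (2 : ℝ) < N := by exact_mod_cast hN
  have hsin : 0 ≤ Real.sin (2 * Real.pi / N) := by
    refine Real.sin_nonneg_of_nonneg_of_le_pi (by positivity) ?_
    rw [div_le_iff₀ (by linarith)]
    nlinarith [Real.pi_pos]
  set T : ℕ → Set ℂ := fun k =>
    (rotation (Circle.exp (-(k * (2 * Real.pi / N))))) ⁻¹'
      (unitPolygon N ∩ sector (2 * Real.pi / N)) with hT
  have hmeas : MeasurableSet (unitPolygon N ∩ sector (2 * Real.pi / N)) :=
    (isClosed_unitPolygon N).measurableSet.inter (measurableSet_sector _)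
  have hvol : ∀ k, volume (T k) = ENNReal.ofReal (Real.sin (2 * Real.pi / N) / 2) := fun k => by
    rw [hT, (LinearIsometryEquiv.measurePreserving _).measure_preimage hmeas.nullMeasurableSet,
      unitPolygon_inter_sector hN, Measure.addHaar_image_linearMap, det_sectorMap,
      volume_half_open_triangle, abs_of_nonneg hsin, ← ENNReal.ofReal_mul hsin]
    congr 1
    ring
  have hroot : ∀ k : ℕ, Complex.exp ((-(k * (2 * Real.pi / N)) : ℝ) * Complex.I) ^ N = 1 := by
    intro k
    rw [← Complex.exp_nat_mul, Complex.exp_eq_one_iff]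
    refine ⟨-k, ?_⟩
    push_cast
    field_simp
  have hcover : unitPolygon N \ {0} = ⋃ k ∈ Finset.range N, T k := by
    ext z
    simp only [Set.mem_sdiff, Set.mem_singleton_iff, Set.mem_iUnion, Finset.mem_range, hT,
      Set.mem_preimage, rotation_apply, Circle.coe_exp, Set.mem_inter_iff, exists_prop]
    constructor
    · rintro ⟨hz, hz0⟩
      obtain ⟨k, hk, hmem⟩ := exists_rotation_mem_sector hN hz0
      exact ⟨k, hk, mul_mem_unitPolygon hN0 (hroot k) hz, hmem⟩
    · rintro ⟨k, hk, hz, hmem⟩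
      refine ⟨?_, fun h => hmem.1 (by rw [h, mul_zero])⟩
      have := mul_mem_unitPolygon hN0 (u := (Complex.exp ((-(k * (2 * Real.pi / N)) : ℝ) *
        Complex.I))⁻¹) (by rw [inv_pow, hroot, inv_one]) hz
      rwa [inv_mul_cancel_left₀ (Complex.exp_ne_zero _)] at this
  rw [← measure_sdiff_null (measure_singleton (0 : ℂ)), hcover, measure_biUnion_finset]
  · simp only [hvol, Finset.sum_const, Finset.card_range, nsmul_eq_mul]
    rw [← ENNReal.ofReal_natCast, ← ENNReal.ofReal_mul (by positivity), ← mul_div_assoc]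
  · intro j hj k hk hjk
    refine Set.disjoint_left.2 fun z hzj hzk => hjk ?_
    simp only [hT, Set.mem_preimage, rotation_apply, Circle.coe_exp] at hzj hzk
    exact eq_of_rotation_mem_sector hN (Finset.mem_range.1 hj) (Finset.mem_range.1 hk)
      hzj.2 hzk.2
  · exact fun k _ => (LinearIsometryEquiv.continuous _).measurable hmeas

/-- The hull is the join of the apex with the base; `s` is the weight of the apex. -/
theorem mem_regularPyramid_iff {N : ℕ} (hN : N ≠ 0) (a h : ℝ) (z : ℂ) (t : ℝ) :
    (z, t) ∈ regularPyramid N a h ↔ ∃ s, 0 ≤ s ∧ s ≤ 1 ∧ t = s * h ∧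
      z ∈ ((1 - s) * (a / (2 * Real.sin (Real.pi / N)))) • unitPolygon N := by
  have : NeZero N := ⟨hN⟩
  set ρ := a / (2 * Real.sin (Real.pi / N)) with hρ
  let F : ℂ →ₗ[ℝ] ℂ × ℝ := (LinearMap.inl ℝ ℂ ℝ).comp (LinearMap.lsmul ℝ ℂ ρ)
  have hrange : (Set.range fun k : Fin N => (((ρ : ℝ) : ℂ) *
      Complex.exp ((2 * Real.pi * ((k : ℕ) : ℝ) / (N : ℝ) : ℝ) * Complex.I), (0 : ℝ))) =
      F '' Set.range fun k : Fin N =>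
        Complex.exp ((2 * Real.pi * ((k : ℕ) : ℝ) / (N : ℝ) : ℝ) * Complex.I) := by
    rw [← Set.range_comp]
    rfl
  rw [regularPyramid, ← hρ, hrange, convexHull_insert ((Set.range_nonempty _).image _),
    ← LinearMap.image_convexHull, ← unitPolygon, mem_convexJoin]
  constructor
  · rintro ⟨_, rfl, _, ⟨p, hp, rfl⟩, u, v, hu, hv, huv, heq⟩
    rw [Prod.ext_iff] at heq
    simp [F] at heq
    refine ⟨u, hu, by linarith, heq.2.symm, p, hp, ?_⟩
    rw [← heq.1]
    simp only [Complex.real_smul]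
    rw [show v = 1 - u by linarith]
    push_cast
    ring
  · rintro ⟨s, h0, h1, rfl, p, hp, rfl⟩
    refine ⟨_, rfl, _, ⟨p, hp, rfl⟩, s, 1 - s, h0, by linarith, by ring, ?_⟩
    rw [Prod.ext_iff]
    simp [F, mul_assoc]

theorem volume_regularPyramid {N : ℕ} (hN : 2 < N) {a h : ℝ} (hh : 0 ≤ h) :
    volume (regularPyramid N a h) =
      ENNReal.ofReal (N * a ^ 2 / 12 * Real.cot (Real.pi / N) * h) := by
  have hN0 : N ≠ 0 := by omega
  have hN' : (2 : ℝ) < N := by exact_mod_cast hN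
  have hclosed : IsClosed (regularPyramid N a h) :=
    ((Set.finite_range _).insert _).isClosed_convexHull ℝ
  rw [Measure.volume_eq_prod, Measure.prod_apply_symm hclosed.measurableSet]
  -- For zero height the pyramid lies in a null plane, and slices cannot be parametrized by `t / h`.
  rcases hh.eq_or_lt with rfl | hpos
  · rw [mul_zero, ENNReal.ofReal_zero, lintegral_eq_zero_iff' (by
      exact (measurable_measure_prodMk_right hclosed.measurableSet).aemeasurable)]
    have : ∀ᵐ t : ℝ, t ≠ 0 := by simp [ae_iff]
    filter_upwards [this] with t ht
    rw [Set.eq_empty_of_forall_notMem (s := (fun x : ℂ => (x, t)) ⁻¹' _) fun z hz => ?_]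
    · simp
    · obtain ⟨s, _, _, hs, _⟩ := (mem_regularPyramid_iff hN0 _ _ _ _).1 hz
      exact ht (by simpa using hs)
  · have hsin : 0 < Real.sin (Real.pi / N) := by
      refine Real.sin_pos_of_pos_of_lt_pi (by positivity) ?_
      rw [div_lt_iff₀ (by linarith)]
      nlinarith [Real.pi_pos]
    have hcos : 0 < Real.cos (Real.pi / N) := by
      refine Real.cos_pos_of_mem_Ioo ⟨?_, ?_⟩
      · have : 0 < Real.pi / N := by positivity
        linarith [Real.pi_pos]
      · exact div_lt_div_of_pos_left Real.pi_pos two_pos hN'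
    -- `B` is the area of the base.
    set B : ℝ := N * a ^ 2 / 4 * Real.cot (Real.pi / N) with hB
    have hB0 : 0 ≤ B := by
      rw [hB, Real.cot_eq_cos_div_sin]; positivity
    have hslice : ∀ t : ℝ, volume ((fun x : ℂ => (x, t)) ⁻¹' regularPyramid N a h) =
        (Set.Icc 0 h).indicator (fun t => ENNReal.ofReal ((1 - t / h) ^ 2 * B)) t := fun t => by
      by_cases ht : t ∈ Set.Icc 0 h
      · have : (fun x : ℂ => (x, t)) ⁻¹' regularPyramid N a h =
            ((1 - t / h) * (a / (2 * Real.sin (Real.pi / N)))) • unitPolygon N := by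
          ext z
          rw [Set.mem_preimage, mem_regularPyramid_iff hN0]
          constructor
          · rintro ⟨s, _, _, rfl, hz⟩
            rwa [mul_div_cancel_right₀ _ hpos.ne']
          · intro hz
            exact ⟨t / h, div_nonneg ht.1 hh, (div_le_one hpos).2 ht.2, by field_simp, hz⟩
        rw [this, Measure.addHaar_smul, Complex.finrank_real_complex, volume_unitPolygon hN,
          Set.indicator_of_mem ht, abs_of_nonneg (by positivity),
          ← ENNReal.ofReal_mul (by positivity)]
        congr 1
        rw [hB, Real.cot_eq_cos_div_sin, mul_div_assoc 2, Real.sin_two_mul]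
        field_simp
        ring
      · rw [Set.indicator_of_notMem ht, Set.eq_empty_of_forall_notMem
          (s := (fun x : ℂ => (x, t)) ⁻¹' _) fun z hz => ?_, measure_empty]
        obtain ⟨s, h0, h1, rfl, _⟩ := (mem_regularPyramid_iff hN0 _ _ _ _).1 hz
        exact ht ⟨by positivity, by nlinarith⟩
    simp only [hslice]
    rw [lintegral_indicator measurableSet_Icc, ← ofReal_integral_eq_lintegral_ofReal]
    · rw [integral_Icc_eq_integral_Ioc, ← intervalIntegral.integral_of_le hh]
      congr 1
      have hd : ∀ x ∈ Set.uIcc 0 h, HasDerivAt (fun t : ℝ => -(h / 3 * (1 - t / h) ^ 3 * B))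
          ((1 - x / h) ^ 2 * B) x := fun x _ => by
        have h1 : HasDerivAt (fun t : ℝ => 1 - t / h) (-(1 / h)) x :=
          ((hasDerivAt_id x).div_const h).const_sub 1
        refine (((h1.fun_pow 3).const_mul (h / 3)).mul_const B).fun_neg.congr_deriv ?_
        generalize 1 - x / h = u
        field_simp
        push_cast
        ring
      rw [intervalIntegral.integral_eq_sub_of_hasDerivAt hd
        (Continuous.intervalIntegrable (by fun_prop) _ _), hB]
      field_simp
      ring
    · exact Continuous.integrableOn_Icc (by fun_prop)
    · exact ae_restrict_of_forall_mem measurableSet_Icc fun y hy => by positivity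

end GME
end

/-! ### The volume as a function of the concurrences, and conclusion -/

noncomputable section
namespace GME
open Finset

theorem two_le_card_of_mem_higherBipartitions {N : ℕ} {S : Finset (Fin N)}
    (hS : S ∈ higherBipartitions N) : 2 ≤ S.card ∧ 2 * S.card ≤ N := by
  simp only [higherBipartitions, mem_filter, mem_univ, true_and] at hS
  omega

theorem singleton_notMem_higherBipartitions {N : ℕ} (i : Fin N) :
    {i} ∉ higherBipartitions N := fun h => by
  have := (two_le_card_of_mem_higherBipartitions h).1
  simp at this

theorem singleton_or_mem_higherBipartitions_or_compl {N : ℕ} {S : Finset (Fin N)}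
    (hS : S.Nonempty) (hS' : S ≠ univ) :
    ((∃ i, S = {i}) ∨ S ∈ higherBipartitions N) ∨
      ((∃ i, Sᶜ = {i}) ∨ Sᶜ ∈ higherBipartitions N) := by
  have h1 := hS.card_pos
  have h2 : 0 < Sᶜ.card := card_pos.2 (by rwa [nonempty_iff_ne_empty, Ne, compl_eq_empty_iff])
  have h3 : S.card + Sᶜ.card = N := by rw [card_add_card_compl, Fintype.card_fin]
  simp only [← card_eq_one, higherBipartitions, mem_filter, mem_univ, true_and]
  -- When the sides have equal size, the position of the first party decides which of them is
  -- listed.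
  have h4 : (∃ i ∈ S, (i : ℕ) = 0) ∨ (∃ i ∈ Sᶜ, (i : ℕ) = 0) := by
    by_cases h : (⟨0, by omega⟩ : Fin N) ∈ S
    · exact .inl ⟨_, h, rfl⟩
    · exact .inr ⟨_, mem_compl.2 h, rfl⟩
  rcases h4 with h4 | h4 <;> simp only [h4, and_true] <;> omega

/-- The denominator of the exponent in `height`; it is zero for `N = 3`. Its positivity lets zeros
and strict inequalities pass through the power. -/
theorem two_pow_sub_sub_one_pos {N : ℕ} (hN : 3 < N) : 0 < (2 : ℝ) ^ (N - 1) - (N : ℝ) - 1 := by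
  have : N + 1 < 2 ^ (N - 1) := by
    induction N, hN using Nat.le_induction with
    | base => norm_num
    | succ n hn ih =>
      obtain ⟨m, rfl⟩ : ∃ m, n = m + 1 := ⟨n - 1, by omega⟩
      simp only [Nat.add_sub_cancel] at ih ⊢
      rw [pow_succ]
      omega
  have : (N : ℝ) + 1 < 2 ^ (N - 1) := by exact_mod_cast this
  linarith

theorem cot_pi_div_pos {N : ℕ} (hN : 2 < N) : 0 < Real.cot (Real.pi / N) := by
  have hN' : (2 : ℝ) < N := by exact_mod_cast hN
  have h0 : 0 < Real.pi / N := by positivity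
  have h1 : Real.pi / N < Real.pi / 2 := div_lt_div_of_pos_left Real.pi_pos two_pos hN'
  rw [Real.cot_eq_cos_div_sin]
  exact div_pos (Real.cos_pos_of_mem_Ioo ⟨by linarith, h1⟩)
    (Real.sin_pos_of_pos_of_lt_pi h0 (by linarith))

section pyramidVolume

variable {N : ℕ} {c c' : Finset (Fin N) → ℝ}

theorem baseLength_nonneg (hc : ∀ i, 0 ≤ c {i}) : 0 ≤ baseLength c :=
  Real.rpow_nonneg (prod_nonneg fun i _ => hc i) _

theorem height_nonneg (hc : ∀ S ∈ higherBipartitions N, 0 ≤ c S) : 0 ≤ height c :=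
  Real.rpow_nonneg (prod_nonneg hc) _

theorem baseLength_pos (hc : ∀ i, 0 < c {i}) : 0 < baseLength c :=
  Real.rpow_pos_of_pos (prod_pos fun i _ => hc i) _

theorem height_pos (hc : ∀ S ∈ higherBipartitions N, 0 < c S) : 0 < height c :=
  Real.rpow_pos_of_pos (prod_pos hc) _

theorem pyramidVolume_nonneg (hN : 3 < N)
    (hc : ∀ S, (∃ i, S = {i}) ∨ S ∈ higherBipartitions N → 0 ≤ c S) : 0 ≤ pyramidVolume c := by
  have h1 := (cot_pi_div_pos (by omega : 2 < N)).le
  have h2 := baseLength_nonneg fun i => hc {i} (.inl ⟨i, rfl⟩)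
  have h3 := height_nonneg fun S hS => hc S (.inr hS)
  unfold pyramidVolume
  positivity

theorem pyramidVolume_eq_zero_iff (hN : 3 < N)
    (hc : ∀ S, (∃ i, S = {i}) ∨ S ∈ higherBipartitions N → 0 ≤ c S) :
    pyramidVolume c = 0 ↔ ∃ S, ((∃ i, S = {i}) ∨ S ∈ higherBipartitions N) ∧ c S = 0 := by
  have h1 := (cot_pi_div_pos (by omega : 2 < N)).ne'
  have hN0 : (N : ℝ) ≠ 0 := by norm_cast; omega
  have h4 := two_pow_sub_sub_one_pos hN
  rw [pyramidVolume, baseLength, height, mul_eq_zero, mul_eq_zero, or_iff_left h1, div_eq_zero_iff,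
    or_iff_left (b := (12 : ℝ) = 0) (by norm_num), mul_eq_zero, or_iff_right hN0, pow_eq_zero_iff two_ne_zero,
    Real.rpow_eq_zero (prod_nonneg fun i _ => hc {i} (.inl ⟨i, rfl⟩)) (by positivity),
    Real.rpow_eq_zero (prod_nonneg fun S hS => hc S (.inr hS)) (by positivity),
    prod_eq_zero_iff, prod_eq_zero_iff]
  constructor
  · rintro (⟨i, _, h⟩ | ⟨S, hS, h⟩)
    · exact ⟨_, .inl ⟨i, rfl⟩, h⟩
    · exact ⟨S, .inr hS, h⟩
  · rintro ⟨_, ⟨i, rfl⟩ | hS, h⟩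
    · exact .inl ⟨i, mem_univ _, h⟩
    · exact .inr ⟨_, hS, h⟩

theorem pyramidVolume_le_pyramidVolume (hN : 3 < N)
    (h : ∀ S, (∃ i, S = {i}) ∨ S ∈ higherBipartitions N → 0 ≤ c S ∧ c S ≤ c' S) :
    pyramidVolume c ≤ pyramidVolume c' := by
  have h1 := (cot_pi_div_pos (by omega : 2 < N)).le
  have h2 := baseLength_nonneg fun i => (h {i} (.inl ⟨i, rfl⟩)).1
  have h3 := height_nonneg fun S hS => (h S (.inr hS)).1
  have h4 := two_pow_sub_sub_one_pos hN
  have hb : baseLength c ≤ baseLength c' :=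
    Real.rpow_le_rpow (prod_nonneg fun i _ => (h {i} (.inl ⟨i, rfl⟩)).1)
      (prod_le_prod (fun i _ => (h {i} (.inl ⟨i, rfl⟩)).1)
        fun i _ => (h {i} (.inl ⟨i, rfl⟩)).2) (by positivity)
  have hh : height c ≤ height c' :=
    Real.rpow_le_rpow (prod_nonneg fun S hS => (h S (.inr hS)).1)
      (prod_le_prod (fun S hS => (h S (.inr hS)).1) fun S hS => (h S (.inr hS)).2) (by positivity)
  unfold pyramidVolume
  gcongr

theorem pyramidVolume_lt_pyramidVolume_update (hN : 3 < N) {S : Finset (Fin N)} {t : ℝ}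
    (hS : (∃ i, S = {i}) ∨ S ∈ higherBipartitions N)
    (hc : ∀ T, (∃ i, T = {i}) ∨ T ∈ higherBipartitions N → T ≠ S → 0 < c T)
    (h0 : 0 ≤ c S) (ht : c S < t) :
    pyramidVolume c < pyramidVolume (Function.update c S t) := by
  have h1 := cot_pi_div_pos (by omega : 2 < N)
  have h4 := two_pow_sub_sub_one_pos hN
  have hN0 : (0 : ℝ) < N := by norm_cast; omega
  -- One statement serves both products, with `f` the singleton map or the identity. Exactly one
  -- factor changes and the others are positive; `c S` itself may be zero.
  have hlt : ∀ {κ : Type} [DecidableEq κ] (I : Finset κ) (f : κ → Finset (Fin N)) (k : κ), k ∈ I →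
      f k = S → (∀ j ∈ I, j ≠ k → f j ≠ S) →
      (∀ j ∈ I, (∃ i, f j = {i}) ∨ f j ∈ higherBipartitions N) →
      0 ≤ ∏ j ∈ I, c (f j) ∧ ∏ j ∈ I, c (f j) < ∏ j ∈ I, Function.update c S t (f j) := by
    intro κ _ I f k hk hfk hne hI
    have hpos : 0 < ∏ j ∈ I.erase k, c (f j) := prod_pos fun j hj =>
      hc _ (hI j (mem_of_mem_erase hj)) (hne j (mem_of_mem_erase hj) (ne_of_mem_erase hj))
    have heq : ∏ j ∈ I.erase k, Function.update c S t (f j) = ∏ j ∈ I.erase k, c (f j) :=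
      prod_congr rfl fun j hj => Function.update_of_ne
        (hne j (mem_of_mem_erase hj) (ne_of_mem_erase hj)) _ _
    rw [← mul_prod_erase I _ hk, ← mul_prod_erase I (fun j => Function.update c S t (f j)) hk, heq,
      hfk, Function.update_self]
    exact ⟨by positivity, by gcongr⟩
  rcases hS with ⟨i, rfl⟩ | hS
  · have hne : ∀ T ∈ higherBipartitions N, T ≠ {i} := by
      rintro T hT rfl
      exact singleton_notMem_higherBipartitions i hT
    have hp := height_pos fun T hT => hc T (.inr hT) (hne T hT)
    have hh : height (Function.update c {i} t) = height c := by
      rw [height, height, prod_congr rfl fun T hT => Function.update_of_ne (hne T hT) _ _]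
    obtain ⟨hb0, hb⟩ := hlt univ (fun j => {j}) i (mem_univ _) rfl
      (fun j _ hj h => hj (singleton_injective h)) fun j _ => .inl ⟨j, rfl⟩
    have hb' : baseLength c < baseLength (Function.update c {i} t) :=
      Real.rpow_lt_rpow hb0 hb (by positivity)
    have hb0' : 0 ≤ baseLength c := Real.rpow_nonneg hb0 _
    unfold pyramidVolume
    rw [hh]
    gcongr
  · have hne : ∀ i : Fin N, {i} ≠ S := by
      rintro i rfl
      exact singleton_notMem_higherBipartitions i hS
    have hp := baseLength_pos fun i => hc {i} (.inl ⟨i, rfl⟩) (hne i)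
    have hb : baseLength (Function.update c S t) = baseLength c := by
      rw [baseLength, baseLength, prod_congr rfl fun i _ => Function.update_of_ne (hne i) _ _]
    obtain ⟨hh0, hh⟩ := hlt (higherBipartitions N) id S hS rfl
      (fun j _ hj => hj) fun j hj => .inr hj
    have hh' : height c < height (Function.update c S t) :=
      Real.rpow_lt_rpow hh0 hh (by positivity)
    unfold pyramidVolume
    rw [hb]
    gcongr

end pyramidVolume

theorem concurrence_nonneg {N : ℕ} {d : Fin N → ℕ} (ψ : Ket d) (S : Finset (Fin N)) :
    0 ≤ concurrence ψ S := Real.sqrt_nonneg _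

theorem V_nonneg {N : ℕ} (hN : 3 < N) {d : Fin N → ℕ} (ψ : Ket d) : 0 ≤ V d ψ :=
  pyramidVolume_nonneg hN fun S _ => concurrence_nonneg ψ S

theorem V_eq_zero_iff {N : ℕ} (hN : 3 < N) {d : Fin N → ℕ} {ψ : Ket d} (hψ : ‖ψ‖ = 1) :
    V d ψ = 0 ↔ IsProductAcrossSome ψ := by
  rw [V, pyramidVolume_eq_zero_iff hN fun S _ => concurrence_nonneg ψ S]
  simp only [concurrence_eq_minorNorm hψ]
  constructor
  · rintro ⟨S, hS, h⟩
    rw [minorNorm_eq_zero_iff] at h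
    have hcard : 0 < S.card ∧ S.card < N := by
      rcases hS with ⟨i, rfl⟩ | hS
      · rw [card_singleton]; omega
      · have := two_le_card_of_mem_higherBipartitions hS
        omega
    refine ⟨S, card_pos.1 hcard.1, ?_, h⟩
    rintro rfl
    simp at hcard
  · rintro ⟨S, hS, hS', h⟩
    rw [← minorNorm_eq_zero_iff] at h
    rcases singleton_or_mem_higherBipartitions_or_compl hS hS' with hm | hm
    · exact ⟨S, hm, h⟩
    · exact ⟨Sᶜ, hm, by rw [minorNorm_compl, h]⟩

theorem isGMEMeasure_V {N : ℕ} (hN : 3 < N) : IsGMEMeasure N (fun d ψ => V d ψ) where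
  zero_of_biseparable _ _ hψ h := (V_eq_zero_iff hN hψ).2 ((isBiseparable_density_iff hψ).1 h)
  pos_of_not_biseparable _ ψ hψ h := (V_nonneg hN ψ).lt_of_ne' fun h0 =>
    h ((isBiseparable_density_iff hψ).2 ((V_eq_zero_iff hN hψ).1 h0))
  locc_le _ _ _ hΛ _ φ hψ hφ h := pyramidVolume_le_pyramidVolume hN fun S _ =>
    ⟨concurrence_nonneg φ S, hΛ.concurrence_le hψ hφ h S⟩

theorem volume_regularPyramid_concurrence {N : ℕ} (hN : 3 < N) {d : Fin N → ℕ} (ψ : Ket d) :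
    MeasureTheory.volume (regularPyramid N (baseLength (concurrence ψ))
      (height (concurrence ψ))) = ENNReal.ofReal (V d ψ) :=
  volume_regularPyramid (by omega) (height_nonneg fun _ _ => concurrence_nonneg ψ _)

theorem higherBipartitions_four : higherBipartitions 4 = {{0, 1}, {0, 2}, {0, 3}} := by
  decide

theorem V_four (d : Fin 4 → ℕ) (ψ : Ket d) : V d ψ = V1234 d ψ := by
  have hcot : Real.cot (Real.pi / (4 : ℕ)) = 1 := by
    rw [Real.cot_eq_cos_div_sin, Nat.cast_ofNat, Real.cos_pi_div_four, Real.sin_pi_div_four,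
      div_self (by positivity)]
  rw [V, V1234, pyramidVolume, hcot, baseLength, height, higherBipartitions_four,
    prod_insert (by decide), prod_insert (by decide), prod_singleton, Fin.prod_univ_four]
  norm_num
  ring_nf

end GME
end

theorem theorem2 :
    (∀ N : ℕ, 3 < N →
      -- `V` is a measure of genuine multipartite entanglement
      GME.IsGMEMeasure N (fun d ψ => GME.V d ψ) ∧
      -- for each pure state, `V` is the volume of the pyramid, and its zeros are the products
      (∀ (d : Fin N → ℕ) (ψ : GME.Ket d), ‖ψ‖ = 1 →
        GME.V d ψ = (N : ℝ) * GME.baseLength (GME.concurrence ψ) ^ 2 / 12 *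
          Real.cot (Real.pi / (N : ℝ)) * GME.height (GME.concurrence ψ) ∧
        MeasureTheory.volume (GME.regularPyramid N (GME.baseLength (GME.concurrence ψ))
          (GME.height (GME.concurrence ψ))) = ENNReal.ofReal (GME.V d ψ) ∧
        0 ≤ GME.V d ψ ∧
        (GME.V d ψ = 0 ↔ GME.IsProductAcrossSome ψ)) ∧
      -- the volume is non-decreasing in all concurrences
      (∀ c c' : Finset (Fin N) → ℝ,
        (∀ S, (∃ i, S = {i}) ∨ S ∈ GME.higherBipartitions N → 0 ≤ c S ∧ c S ≤ c' S) →
        GME.pyramidVolume c ≤ GME.pyramidVolume c') ∧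
      -- and strictly increasing in each of them when the others are positive
      (∀ (c : Finset (Fin N) → ℝ) (S : Finset (Fin N)) (t : ℝ),
        ((∃ i, S = {i}) ∨ S ∈ GME.higherBipartitions N) →
        (∀ T, (∃ i, T = {i}) ∨ T ∈ GME.higherBipartitions N → T ≠ S → 0 < c T) →
        0 ≤ c S → c S < t →
        GME.pyramidVolume c < GME.pyramidVolume (Function.update c S t))) ∧
    -- for four parties, `V` is the four-party volume
    (∀ (d : Fin 4 → ℕ) (ψ : GME.Ket d), ‖ψ‖ = 1 → GME.V d ψ = GME.V1234 d ψ) := by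
  refine ⟨fun N hN => ⟨GME.isGMEMeasure_V hN, fun d ψ hψ => ⟨rfl,
    GME.volume_regularPyramid_concurrence hN ψ, GME.V_nonneg hN ψ, GME.V_eq_zero_iff hN hψ⟩,
    fun _ _ h => GME.pyramidVolume_le_pyramidVolume hN h,
    fun _ _ _ hS hc h0 ht => GME.pyramidVolume_lt_pyramidVolume_update hN hS hc h0 ht⟩,
    fun d ψ _ => GME.V_four d ψ⟩
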